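/- Let $\theta\in(0,1]$, let $\lambda:[0,\infty)\to[0,\infty)$ be locally integrable with $\Lambda_t=\int_0^t\lambda_u\,du$, and let $a:[0,\infty)\to[0,1+1/\theta]$ be measurable. Let $\{Z_t\}_{t\ge0}$, $Z_0=1$, be the theta-positive Markov branching process in the varying environment $(\lambda,a)$, that is, the time-inhomogeneous càdlàg Markov branching process with values in $\{0,1,2,\dots\}$ in which, independently of the others, each individual alive at time $t$ dies at rate $\lambda_t$ and is instantaneously replaced by $k$ offspring with probability $p_t(k)$, where $$\sum_{k\ge0}p_t(k)s^k=1-a_t(1-s)+\frac{a_t}{1+\theta}(1-s)^{1+\theta},\qquad 0\le s\le1 .$$ Then $\mu_t=E(Z_t)$ is finite and $\mu_t=\exp\{\int_0^t(a_u-1)\lambda_u\,du\}$ for all $t\ge0$. Put $$V_{t,\theta}=\frac{\theta}{1+\theta}\int_0^t\mu_u^{-\theta}\lambda_u\,du,\quad V_\theta=\lim_{t\to\infty}V_{t,\theta}\in[0,\infty],\quad \Lambda=\lim_{t\to\infty}\Lambda_t\in[0,\infty],\quad q=\lim_{t\to\infty}P(Z_t=0).$$ The process is called supercritical if $q<1$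 and $\lim_{t\to\infty}\mu_t=\infty$. The process is supercritical if and only if $V_\theta<\infty$ and $\Lambda=\infty$. In this case $\mu_t\to\infty$ as $t\to\infty$, $$q=1-\Big(V_\theta+\frac1{1+\theta}\Big)^{-1/\theta},$$ and $\mu_t^{-1}Z_t$ converges almost surely, as $t\to\infty$, to a finite non-negative random variable $W$ with $$E(e^{-wW})=1-\Big(V_\theta+\frac1{1+\theta}+w^{-\theta}\Big)^{-1/\theta},\qquad w>0 .$$ -/

import Mathlib

open MeasureTheory ProbabilityTheory Filter Topology Set
open scoped NNReal ENNReal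

noncomputable section

namespace ThetaBranching

/-- The theta-positive offspring law with parameter `θ` and mean `a`:
`p 0 = 1 - θ a / (1 + θ)`, `p 1 = 0` and
`p n = θ (1 - θ) (2 - θ) ⋯ (n - 2 - θ) a / n!` for `n ≥ 2`. -/
def offspring (θ a : ℝ) : ℕ → ℝ
  | 0 => 1 - θ / (1 + θ) * a
  | 1 => 0
  | n + 2 => θ * (∏ i ∈ Finset.range n, ((i : ℝ) + 1 - θ)) * a / ((n + 2).factorial : ℝ)

theorem offspring_nonneg {θ a : ℝ} (hθ : 0 < θ) (hθ1 : θ ≤ 1) (ha : 0 ≤ a)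
    (ha1 : a ≤ 1 + 1 / θ) : ∀ k, 0 ≤ offspring θ a k := by
  intro k
  match k with
  | 0 =>
    have h1 : θ / (1 + θ) * a ≤ θ / (1 + θ) * (1 + 1 / θ) := by gcongr
    have h2 : θ / (1 + θ) * (1 + 1 / θ) = 1 := by field_simp; ring
    simp only [offspring]; linarith
  | 1 => simp [offspring]
  | n + 2 =>
    simp only [offspring]
    have : 0 ≤ ∏ i ∈ Finset.range n, ((i : ℝ) + 1 - θ) :=
      Finset.prod_nonneg fun i _ => by
        have : (0 : ℝ) ≤ i := Nat.cast_nonneg i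
        linarith
    positivity

/-- For `s < 1` the law `offspring θ a` has generating function
`h(s) = 1 - a (1 - s) + a (1 + θ)⁻¹ (1 - s) ^ (1 + θ)`. -/
theorem hasSum_offspring_of_lt {θ : ℝ} (hθ : 0 < θ) (a : ℝ) {s : ℝ} (hs : 0 ≤ s) (hs1 : s < 1) :
    HasSum (fun k => offspring θ a k * s ^ k)
      (1 - a * (1 - s) + a * (1 + θ)⁻¹ * (1 - s) ^ (1 + θ)) := by
  have key := (Real.one_div_one_sub_rpow_hasFPowerSeriesOnBall_zero (-(1 + θ))).hasSum
    (y := s) (by simp [Metric.mem_eball, edist_dist, abs_of_nonneg hs, hs1])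
  have h1 : (0 : ℝ) < 1 - s := by linarith
  have hθ' : (1 + θ) ≠ 0 := by positivity
  simp only [zero_add, FormalMultilinearSeries.ofScalars_apply_eq, Real.rpow_neg h1.le, one_div,
    inv_inv, smul_eq_mul] at key
  have hp : ∀ (n : ℕ) (x : ℝ), (ascPochhammer ℝ n).eval x = ∏ i ∈ Finset.range n, (x + i) := by
    intro n x
    induction n with
    | zero => simp
    | succ n ih => rw [ascPochhammer_succ_eval, ih, Finset.prod_range_succ]
  have hc : ∀ n : ℕ, Ring.choose (-(1 + θ) + n - 1) n
      = (∏ i ∈ Finset.range n, ((i : ℝ) - 1 - θ)) / (n.factorial : ℝ) := by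
    intro n
    rw [eq_div_iff (by positivity), mul_comm, ← nsmul_eq_mul,
      ← Ring.descPochhammer_eq_factorial_smul_choose,
      Polynomial.descPochhammer_smeval_eq_ascPochhammer,
      Polynomial.ascPochhammer_smeval_eq_eval, hp]
    refine Finset.prod_congr rfl fun i _ => ?_
    ring
  have h2 := (key.mul_left (a * (1 + θ)⁻¹)).add
    ((hasSum_ite_eq (0 : ℕ) (1 - a)).add (hasSum_ite_eq (1 : ℕ) (a * s)))
  convert! h2 using 1
  · funext k
    match k with
    | 0 => simp [offspring]; field_simp; ring
    | 1 => simp [offspring]; field_simp; ring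
    | n + 2 =>
      simp only [offspring, hc, Finset.prod_range_succ' _ (n + 1), Finset.prod_range_succ' _ n]
      have : ∀ i ∈ Finset.range n,
          (((i + 1 + 1 : ℕ) : ℝ) - 1 - θ) = (i : ℝ) + 1 - θ := by
        intro i _; push_cast; ring
      rw [Finset.prod_congr rfl this]
      simp
      field_simp
      ring
  · ring

/-- The law `offspring θ a` is a probability distribution with generating function
`h(s) = 1 - a (1 - s) + a (1 + θ)⁻¹ (1 - s) ^ (1 + θ)` on `[0, 1]`. -/
theorem hasSum_offspring {θ a : ℝ} (hθ : 0 < θ) (hθ1 : θ ≤ 1) (ha : 0 ≤ a)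
    (ha1 : a ≤ 1 + 1 / θ) {s : ℝ} (hs : 0 ≤ s) (hs1 : s ≤ 1) :
    HasSum (fun k => offspring θ a k * s ^ k)
      (1 - a * (1 - s) + a * (1 + θ)⁻¹ * (1 - s) ^ (1 + θ)) := by
  rcases hs1.lt_or_eq with h | rfl
  · exact hasSum_offspring_of_lt hθ a hs h
  have h0 := offspring_nonneg hθ hθ1 ha ha1
  have hcont : Tendsto (fun s : ℝ => 1 - a * (1 - s) + a * (1 + θ)⁻¹ * (1 - s) ^ (1 + θ))
      (𝓝[<] 1) (𝓝 1) := by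
    have : ContinuousAt
        (fun s : ℝ => 1 - a * (1 - s) + a * (1 + θ)⁻¹ * (1 - s) ^ (1 + θ)) 1 := by
      have h3 : ContinuousAt (fun s : ℝ => (1 - s) ^ (1 + θ)) 1 :=
        ContinuousAt.rpow_const (by fun_prop) (Or.inr (by positivity))
      fun_prop
    have h4 := this.tendsto.mono_left (nhdsWithin_le_nhds (s := Iio 1))
    simpa [Real.zero_rpow (by positivity : (1 + θ) ≠ 0)] using h4
  have hev : ∀ᶠ s : ℝ in 𝓝[<] 1, 0 ≤ s ∧ s < 1 := by
    filter_upwards [Ioo_mem_nhdsLT (zero_lt_one' ℝ)] with s hs using ⟨hs.1.le, hs.2⟩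
  have hle : ∀ u : Finset ℕ, ∑ k ∈ u, offspring θ a k ≤ 1 := by
    intro u
    have h5 : Tendsto (fun s : ℝ => ∑ k ∈ u, offspring θ a k * s ^ k) (𝓝[<] 1)
        (𝓝 (∑ k ∈ u, offspring θ a k * 1 ^ k)) :=
      ((by fun_prop : Continuous fun s : ℝ => ∑ k ∈ u, offspring θ a k * s ^ k).tendsto
        1).mono_left nhdsWithin_le_nhds
    have h6 := le_of_tendsto_of_tendsto h5 hcont (by
      filter_upwards [hev] with s hs
      exact sum_le_hasSum u (fun k _ => mul_nonneg (h0 k) (pow_nonneg hs.1 k))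
        (hasSum_offspring_of_lt hθ a hs.1 hs.2))
    simpa using h6
  have hsum : Summable (offspring θ a) := summable_of_sum_le h0 hle
  have h7 : (1 : ℝ) ≤ ∑' k, offspring θ a k :=
    le_of_tendsto hcont (by
      filter_upwards [hev] with s hs
      refine hasSum_le (fun k => ?_) (hasSum_offspring_of_lt hθ a hs.1 hs.2) hsum.hasSum
      exact mul_le_of_le_one_right (h0 k) (pow_le_one₀ hs.1 hs.2.le))
  have h8 : ∑' k, offspring θ a k = 1 := le_antisymm (hsum.tsum_le_of_sum_le hle) h7
  simpa [Real.zero_rpow (by positivity : (1 + θ) ≠ 0), h8] using hsum.hasSum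

/-- `A_u f (n) = n λ_u (∑ₖ p_u(k) f(n - 1 + k) - f(n))`: each of the `n` individuals alive at
time `u` dies at rate `λ_u`, independently of the others, and is then instantaneously replaced by
`k` offspring with probability `p_u(k)`. (For `n = 0` the value is `0`: no individual, no event.) -/
def generator (lam : ℝ → ℝ) (p : ℝ → ℕ → ℝ) (f : ℕ → ℝ) (u : ℝ) (n : ℕ) : ℝ :=
  n * lam u * ((∑' k, p u k * f (n - 1 + k)) - f n)

/-- `Z` is a time-inhomogeneous Markov branching process with death rates `lam` and offspring laws
`p`, started from one individual: a càdlàg process with values in the discrete space `ℕ` that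
solves the martingale problem for the generator of independently living and reproducing
individuals, with finitely supported test functions. -/
structure IsMarkovBranchingProcess {Ω : Type*} {mΩ : MeasurableSpace Ω} (P : Measure Ω)
    (ℱ : Filtration ℝ≥0 mΩ) (lam : ℝ → ℝ) (p : ℝ → ℕ → ℝ) (Z : ℝ≥0 → Ω → ℕ) : Prop where
  adapted : ∀ t, Measurable[ℱ t] (Z t)
  start : ∀ ω, Z 0 ω = 1
  right_continuous : ∀ ω t, ContinuousWithinAt (fun u => Z u ω) (Ici t) t
  left_limit : ∀ ω t, ∃ n : ℕ, Tendsto (fun u => Z u ω) (𝓝[<] t) (𝓝 n)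
  martingale : ∀ f : ℕ → ℝ, (Function.support f).Finite →
    Martingale (fun (t : ℝ≥0) ω =>
      f (Z t ω) - ∫ u in (0 : ℝ)..t, generator lam p f u (Z u.toNNReal ω)) ℱ P

/-- The mean population size `μ_t = E(Z_t)`. -/
def mean {Ω : Type*} {mΩ : MeasurableSpace Ω} (P : Measure Ω) (Z : ℝ≥0 → Ω → ℕ) (t : ℝ≥0) : ℝ :=
  ∫ ω, (Z t ω : ℝ) ∂P

/-- Supercritical: `q = lim P(Z_t = 0) < 1` and `μ_t → ∞`. -/
def IsSupercritical {Ω : Type*} {mΩ : MeasurableSpace Ω} (P : Measure Ω)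
    (Z : ℝ≥0 → Ω → ℕ) : Prop :=
  (∃ q < 1, Tendsto (fun t => P.real {ω | Z t ω = 0}) atTop (𝓝 q)) ∧
    Tendsto (mean P Z) atTop atTop

/-- The cumulative hazard function `Λ_t = ∫₀ᵗ λ_u du`. -/
def cumHazard (lam : ℝ → ℝ) (t : ℝ≥0) : ℝ :=
  ∫ u in (0 : ℝ)..t, lam u

/-- `V_{t,θ} = θ / (1 + θ) ∫₀ᵗ μ_u^{-θ} dΛ_u`, for a given mean function `μ`. -/
def V (θ : ℝ) (lam : ℝ → ℝ) (μ : ℝ≥0 → ℝ) (t : ℝ≥0) : ℝ :=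
  θ / (1 + θ) * ∫ u in (0 : ℝ)..t, μ u.toNNReal ^ (-θ) * lam u

end ThetaBranching

end

noncomputable section

namespace ThetaBranching

/-! ### Absolutely continuous functions with a prescribed almost everywhere derivative -/

/-! Write F_{u,t}(s) for the generating function at time t of the progeny of one individual alive at
time u. It should solve the backward equation ∂F/∂u = -λ_u (h_u(F) - F), F_{t,t}(s) = s. For the
theta-positive law this is a Bernoulli equation in 1 - F. The quantity μ_u^{-θ} (1 - F)^{-θ}, which
is `survAux`, has a u-derivative that does not involve F, so `pgf` is explicit. As λ is only locally
integrable, derivatives exist almost everywhere and the calculus is that of absolutely continuous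
functions.

The process is given by a martingale problem with finitely supported test functions, which yields
only the forward equation for the probabilities of single states (`forward_equation`). `duality`
pairs these probabilities with the powers of a backward solution and lets the truncation of the
state space tend to infinity. The result is E(s^{Z_t}; B) = E(F_{r,t}(s)^{Z_r}; B) for B in the past
of r (`setIntegral_pow`).

All else is read off from this formula. Letting s → 1 gives conditional means, hence the martingale
Z_t / μ_t. Taking s = 0 gives extinction: (1 - P(Z_t = 0))^{-θ} = V_t + 1/(1+θ) + θ/(1+θ) μ_t^{-θ}.
Taking s = exp(-w/μ_t) gives the Laplace transform of the limit.

If μ_t → ∞ and q < 1, the extinction formula forces V to converge, and log μ ≤ Λ/θ forces Λ = ∞. The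
converse is `Admissible.tendsto_logMean`: V dominates a multiple of Λ unless μ^{-θ} → 0. For almost
sure convergence in continuous time, the Laplace transform shows that W has mean at least 1, so no
mass is lost along the integers; `ae_tendsto_of_integral_le` then controls the oscillation between
integers by Doob's maximal inequality. -/

/-- `F` is absolutely continuous on `uIcc a b` with almost everywhere derivative `f`. -/
structure HasACDeriv (F f : ℝ → ℝ) (a b : ℝ) : Prop where
  ac : AbsolutelyContinuousOnInterval F a b
  deriv : ∀ᵐ x, x ∈ uIcc a b → HasDerivAt F (f x) x

namespace HasACDeriv

variable {F G f g : ℝ → ℝ} {a b : ℝ}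

theorem continuousOn (h : HasACDeriv F f a b) : ContinuousOn F (uIcc a b) := h.ac.continuousOn

theorem deriv_ae_eq (h : HasACDeriv F f a b) : ∀ᵐ x, x ∈ uIcc a b → _root_.deriv F x = f x := by
  filter_upwards [h.deriv] with x hx hm using (hx hm).deriv

theorem intervalIntegrable (h : HasACDeriv F f a b) : IntervalIntegrable f volume a b := by
  refine h.ac.intervalIntegrable_deriv.congr_ae ?_
  rw [EventuallyEq, ae_restrict_iff' measurableSet_uIoc]
  filter_upwards [h.deriv_ae_eq] with x hx hm using hx (uIoc_subset_uIcc hm)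

theorem integral_eq_sub (h : HasACDeriv F f a b) : ∫ x in a..b, f x = F b - F a := by
  rw [← h.ac.integral_deriv_eq_sub]
  refine intervalIntegral.integral_congr_ae ?_
  filter_upwards [h.deriv_ae_eq] with x hx hm using (hx (uIoc_subset_uIcc hm)).symm

theorem mono (h : HasACDeriv F f a b) {c d : ℝ} (hcd : uIcc c d ⊆ uIcc a b) :
    HasACDeriv F f c d :=
  ⟨h.ac.mono hcd, by filter_upwards [h.deriv] with x hx hm using hx (hcd hm)⟩

theorem congr_deriv (h : HasACDeriv F f a b) (hfg : ∀ x ∈ uIcc a b, f x = g x) :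
    HasACDeriv F g a b :=
  ⟨h.ac, by filter_upwards [h.deriv] with x hx hm using hfg x hm ▸ hx hm⟩

theorem _root_.IntervalIntegrable.hasACDeriv (h : IntervalIntegrable f volume a b) {c : ℝ}
    (hc : c ∈ uIcc a b) : HasACDeriv (fun x => ∫ u in c..x, f u) f a b :=
  ⟨h.absolutelyContinuousOnInterval_intervalIntegral hc, by
    filter_upwards [h.ae_hasDerivAt_integral] with x hx hm using hx hm c hc⟩

theorem const (c a b : ℝ) : HasACDeriv (fun _ => c) (fun _ => 0) a b :=
  ⟨(LipschitzWith.const c).lipschitzOnWith.absolutelyContinuousOnInterval,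
    .of_forall fun x _ => hasDerivAt_const x c⟩

theorem add (hF : HasACDeriv F f a b) (hG : HasACDeriv G g a b) :
    HasACDeriv (fun x => F x + G x) (fun x => f x + g x) a b :=
  ⟨hF.ac.add hG.ac, by
    filter_upwards [hF.deriv, hG.deriv] with x h1 h2 hm using (h1 hm).add (h2 hm)⟩

theorem mul (hF : HasACDeriv F f a b) (hG : HasACDeriv G g a b) :
    HasACDeriv (fun x => F x * G x) (fun x => f x * G x + F x * g x) a b :=
  ⟨hF.ac.mul hG.ac, by
    filter_upwards [hF.deriv, hG.deriv] with x h1 h2 hm using (h1 hm).mul (h2 hm)⟩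

theorem const_mul (hF : HasACDeriv F f a b) (c : ℝ) :
    HasACDeriv (fun x => c * F x) (fun x => c * f x) a b :=
  ⟨hF.ac.const_mul c, by
    filter_upwards [hF.deriv] with x h1 hm using (h1 hm).const_mul c⟩

theorem sub (hF : HasACDeriv F f a b) (hG : HasACDeriv G g a b) :
    HasACDeriv (fun x => F x - G x) (fun x => f x - g x) a b :=
  ⟨hF.ac.sub hG.ac, by
    filter_upwards [hF.deriv, hG.deriv] with x h1 h2 hm using (h1 hm).sub (h2 hm)⟩

theorem sum {ι : Type*} (s : Finset ι) {F f : ι → ℝ → ℝ}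
    (h : ∀ i ∈ s, HasACDeriv (F i) (f i) a b) :
    HasACDeriv (fun x => ∑ i ∈ s, F i x) (fun x => ∑ i ∈ s, f i x) a b := by
  classical
  induction s using Finset.induction_on with
  | empty => simpa using const 0 a b
  | insert i s hi ih =>
    simp only [Finset.sum_insert hi]
    exact (h i (Finset.mem_insert_self i s)).add
      (ih fun j hj => h j (Finset.mem_insert_of_mem hj))

/-- The chain rule, for an outer function which is `C¹` on a set containing the range. -/
theorem comp (hF : HasACDeriv F f a b) {φ φ' : ℝ → ℝ} {S : Set ℝ}
    (hφ : ContDiffOn ℝ 1 φ S) (hφ' : ∀ x ∈ S, HasDerivAt φ (φ' x) x)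
    (hFS : MapsTo F (uIcc a b) S) :
    HasACDeriv (fun x => φ (F x)) (fun x => φ' (F x) * f x) a b := by
  refine ⟨?_, by
    filter_upwards [hF.deriv] with x h1 hm using (hφ' _ (hFS hm)).comp x (h1 hm)⟩
  -- The image of the interval is compact and convex, so a C¹ function is Lipschitz on it; a
  -- Lipschitz function of an absolutely continuous one is absolutely continuous.
  have hconn : (F '' uIcc a b).OrdConnected :=
    (isPreconnected_uIcc.image F hF.continuousOn).ordConnected
  obtain ⟨K, hK⟩ := (hφ.mono hFS.image_subset).exists_lipschitzOnWith (by decide)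
    hconn.convex (isCompact_uIcc.image_of_continuousOn hF.continuousOn)
  have hac := hF.ac
  rw [absolutelyContinuousOnInterval_iff] at hac ⊢
  intro ε hε
  obtain ⟨δ, hδ, H⟩ := hac (ε / (K + 1)) (by positivity)
  refine ⟨δ, hδ, fun E hE hlt => ?_⟩
  calc ∑ i ∈ Finset.range E.1, dist (φ (F (E.2 i).1)) (φ (F (E.2 i).2))
      ≤ ∑ i ∈ Finset.range E.1, (K + 1) * dist (F (E.2 i).1) (F (E.2 i).2) := by
        refine Finset.sum_le_sum fun i hi => ?_
        refine (hK.dist_le_mul _ (mem_image_of_mem F (hE.1 i hi).1) _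
          (mem_image_of_mem F (hE.1 i hi).2)).trans ?_
        gcongr
        linarith
    _ = (K + 1) * ∑ i ∈ Finset.range E.1, dist (F (E.2 i).1) (F (E.2 i).2) :=
        (Finset.mul_sum _ _ _).symm
    _ < (K + 1) * (ε / (K + 1)) := by
        have := H E hE hlt
        gcongr
    _ = ε := by field_simp

theorem exp (hF : HasACDeriv F f a b) :
    HasACDeriv (fun x => Real.exp (F x)) (fun x => Real.exp (F x) * f x) a b :=
  hF.comp Real.contDiff_exp.contDiffOn (fun x _ => Real.hasDerivAt_exp x)
    (mapsTo_univ _ _)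

theorem pow (hF : HasACDeriv F f a b) (n : ℕ) :
    HasACDeriv (fun x => F x ^ n) (fun x => n * F x ^ (n - 1) * f x) a b :=
  hF.comp (contDiff_id.pow n).contDiffOn (fun x _ => hasDerivAt_pow n x)
    (mapsTo_univ _ _)

theorem rpow_const (hF : HasACDeriv F f a b) (p : ℝ) (hpos : ∀ x ∈ uIcc a b, 0 < F x) :
    HasACDeriv (fun x => F x ^ p) (fun x => p * F x ^ (p - 1) * f x) a b :=
  hF.comp (S := Ioi 0) (φ' := fun x => p * x ^ (p - 1))
    (fun x (hx : 0 < x) => (Real.contDiffAt_rpow_const_of_ne hx.ne').contDiffWithinAt)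
    (fun x (hx : 0 < x) => Real.hasDerivAt_rpow_const (Or.inl hx.ne')) hpos

end HasACDeriv

/-! ### The explicit solution of the backward equation -/

/-- Admissible parameters of a theta-positive branching process in a varying environment. -/
structure Admissible (θ : ℝ) (lam a : ℝ → ℝ) : Prop where
  theta_pos : 0 < θ
  theta_le_one : θ ≤ 1
  rate_nonneg : ∀ t, 0 ≤ t → 0 ≤ lam t
  rate_integrable : ∀ t, 0 ≤ t → IntervalIntegrable lam volume 0 t
  meas : Measurable a
  nonneg : ∀ t, 0 ≤ t → 0 ≤ a t
  le : ∀ t, 0 ≤ t → a t ≤ 1 + 1 / θ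

/-- `log μ_t`. -/
def logMean (lam a : ℝ → ℝ) (t : ℝ) : ℝ := ∫ u in (0 : ℝ)..t, (a u - 1) * lam u

/-- `V_{t,θ}` in terms of `log μ`. -/
def V' (θ : ℝ) (lam a : ℝ → ℝ) (t : ℝ) : ℝ :=
  ∫ u in (0 : ℝ)..t, θ / (1 + θ) * (Real.exp (-θ * logMean lam a u) * lam u)

/-- `V_{t,θ} + (1 - μ_t^{-θ}) / (1 + θ)`, the primitive of `θ / (1 + θ) a λ μ^{-θ}`. -/
def R (θ : ℝ) (lam a : ℝ → ℝ) (t : ℝ) : ℝ :=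
  V' θ lam a t + (1 + θ)⁻¹ * (1 - Real.exp (-θ * logMean lam a t))

/-- `(1 - F_{u,t}(s)) ^ (-θ)`, where `F_{u,t}` is the generating function at time `t` of the
progeny of an individual alive at time `u`. -/
def survAux (θ : ℝ) (lam a : ℝ → ℝ) (s t u : ℝ) : ℝ :=
  Real.exp (-θ * logMean lam a t) * (1 - s) ^ (-θ) + (R θ lam a t - R θ lam a u)

/-- `F_{u,t}(s)`, the generating function at time `t` of the progeny of an individual alive at
time `u`. -/
def pgf (θ : ℝ) (lam a : ℝ → ℝ) (s t u : ℝ) : ℝ :=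
  1 - Real.exp (-logMean lam a u) * survAux θ lam a s t u ^ (-1 / θ)

/-- The offspring generating function. -/
def offspringGF (θ a s : ℝ) : ℝ := 1 - a * (1 - s) + a * (1 + θ)⁻¹ * (1 - s) ^ (1 + θ)

namespace Admissible

variable {θ : ℝ} {lam a : ℝ → ℝ}

theorem abs_sub_one_le (h : Admissible θ lam a) {t : ℝ} (ht : 0 ≤ t) : |a t - 1| ≤ 1 / θ := by
  have h1 : 1 ≤ 1 / θ := (one_le_div h.theta_pos).2 h.theta_le_one
  rw [abs_le]
  constructor <;> linarith [h.nonneg t ht, h.le t ht]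

theorem hasACDeriv_logMean (h : Admissible θ lam a) {T : ℝ} (hT : 0 ≤ T) :
    HasACDeriv (logMean lam a) (fun u => (a u - 1) * lam u) 0 T := by
  refine IntervalIntegrable.hasACDeriv ?_ left_mem_uIcc
  have h1 := h.rate_integrable T hT
  rw [intervalIntegrable_iff, uIoc_of_le hT] at h1 ⊢
  refine h1.bdd_mul (c := 1 / θ) (h.meas.sub_const 1).aestronglyMeasurable ?_
  filter_upwards [ae_restrict_mem measurableSet_Ioc] with u hu
  exact h.abs_sub_one_le hu.1.le

theorem hasACDeriv_exp_logMean (h : Admissible θ lam a) {T : ℝ} (hT : 0 ≤ T) :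
    HasACDeriv (fun u => Real.exp (-θ * logMean lam a u))
      (fun u => Real.exp (-θ * logMean lam a u) * (-θ * ((a u - 1) * lam u))) 0 T :=
  ((h.hasACDeriv_logMean hT).const_mul (-θ)).exp

theorem hasACDeriv_V' (h : Admissible θ lam a) {T : ℝ} (hT : 0 ≤ T) :
    HasACDeriv (V' θ lam a)
      (fun u => θ / (1 + θ) * (Real.exp (-θ * logMean lam a u) * lam u)) 0 T :=
  IntervalIntegrable.hasACDeriv (((h.rate_integrable T hT).continuousOn_mul
    (h.hasACDeriv_exp_logMean hT).continuousOn).const_mul _) left_mem_uIcc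

/-- The derivative of V cancels the part of the derivative of μ^{-θ} that does not contain a. What
remains is exactly the source term of the linearized Bernoulli equation. -/
theorem hasACDeriv_R (h : Admissible θ lam a) {T : ℝ} (hT : 0 ≤ T) :
    HasACDeriv (R θ lam a)
      (fun u => θ / (1 + θ) * (Real.exp (-θ * logMean lam a u) * (a u * lam u))) 0 T := by
  have h0 : 1 + θ ≠ 0 := by linarith [h.theta_pos]
  refine ((h.hasACDeriv_V' hT).add
    (((HasACDeriv.const 1 0 T).sub (h.hasACDeriv_exp_logMean hT)).const_mul (1 + θ)⁻¹)).congr_deriv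
    fun u _ => ?_
  field_simp
  ring

theorem _root_.ThetaBranching.HasACDeriv.le_of_nonneg {F f : ℝ → ℝ} {T : ℝ}
    (hF : HasACDeriv F f 0 T) (hf : ∀ u, 0 ≤ u → 0 ≤ f u) {s t : ℝ} (hs : 0 ≤ s) (hst : s ≤ t)
    (htT : t ≤ T) : F s ≤ F t := by
  have h1 := (hF.mono (c := s) (d := t) (by
    rw [uIcc_of_le hst, uIcc_of_le (by linarith)]; exact Icc_subset_Icc hs htT)).integral_eq_sub
  have h2 : 0 ≤ ∫ x in s..t, f x :=
    intervalIntegral.integral_nonneg hst fun u hu => hf u (hs.trans hu.1)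
  linarith

theorem R_mono (h : Admissible θ lam a) {s t : ℝ} (hs : 0 ≤ s) (hst : s ≤ t) :
    R θ lam a s ≤ R θ lam a t := by
  refine (h.hasACDeriv_R (hs.trans hst)).le_of_nonneg (fun u hu => ?_) hs hst le_rfl
  have := h.theta_pos
  have := h.rate_nonneg u hu
  have := h.nonneg u hu
  positivity

/-- The derivative is θ μ^{-θ} λ p(0), and p(0) ≥ 0 is the condition a ≤ 1 + 1/θ. This is what keeps
`pgf` nonnegative. -/
theorem R_add_exp_mono (h : Admissible θ lam a) {s t : ℝ} (hs : 0 ≤ s) (hst : s ≤ t) :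
    R θ lam a s + Real.exp (-θ * logMean lam a s)
      ≤ R θ lam a t + Real.exp (-θ * logMean lam a t) := by
  refine ((h.hasACDeriv_R (hs.trans hst)).add
    (h.hasACDeriv_exp_logMean (hs.trans hst))).le_of_nonneg (fun u hu => ?_) hs hst le_rfl
  have h0 := h.theta_pos
  have h1 := h.rate_nonneg u hu
  have h2 : a u * θ ≤ 1 + θ := by
    have := mul_le_mul_of_nonneg_right (h.le u hu) h0.le
    rwa [add_mul, one_mul, one_div, inv_mul_cancel₀ h0.ne', add_comm] at this
  have h3 : θ / (1 + θ) * (Real.exp (-θ * logMean lam a u) * (a u * lam u))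
      + Real.exp (-θ * logMean lam a u) * (-θ * ((a u - 1) * lam u))
      = θ / (1 + θ) * Real.exp (-θ * logMean lam a u) * lam u * (1 + θ - a u * θ) := by
    field_simp
    ring
  rw [h3]
  have : 0 ≤ 1 + θ - a u * θ := by linarith
  positivity

theorem le_survAux (h : Admissible θ lam a) {s t u : ℝ} (hs : 0 ≤ s) (hs1 : s < 1) (hu : 0 ≤ u)
    (hut : u ≤ t) : Real.exp (-θ * logMean lam a u) ≤ survAux θ lam a s t u := by
  have h1 := h.R_add_exp_mono hu hut
  have h2 : 1 ≤ (1 - s) ^ (-θ) :=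
    Real.one_le_rpow_of_pos_of_le_one_of_nonpos (by linarith) (by linarith)
      (by linarith [h.theta_pos])
  have h3 := mul_le_mul_of_nonneg_left h2 (Real.exp_nonneg (-θ * logMean lam a t))
  rw [survAux]
  linarith

theorem survAux_pos (h : Admissible θ lam a) {s t u : ℝ} (hs : 0 ≤ s) (hs1 : s < 1) (hu : 0 ≤ u)
    (hut : u ≤ t) : 0 < survAux θ lam a s t u :=
  (Real.exp_pos _).trans_le (h.le_survAux hs hs1 hu hut)

theorem pgf_lt_one (h : Admissible θ lam a) {s t u : ℝ} (hs : 0 ≤ s) (hs1 : s < 1) (hu : 0 ≤ u)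
    (hut : u ≤ t) : pgf θ lam a s t u < 1 := by
  have := h.survAux_pos hs hs1 hu hut
  have : 0 < Real.exp (-logMean lam a u) * survAux θ lam a s t u ^ (-1 / θ) := by positivity
  rw [pgf]
  linarith

theorem pgf_nonneg (h : Admissible θ lam a) {s t u : ℝ} (hs : 0 ≤ s) (hs1 : s < 1) (hu : 0 ≤ u)
    (hut : u ≤ t) : 0 ≤ pgf θ lam a s t u := by
  have h0 := h.theta_pos
  have h1 : survAux θ lam a s t u ^ (-1 / θ) ≤ Real.exp (-θ * logMean lam a u) ^ (-1 / θ) :=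
    Real.rpow_le_rpow_of_nonpos (Real.exp_pos _) (h.le_survAux hs hs1 hu hut)
      (div_nonpos_of_nonpos_of_nonneg (by norm_num) h0.le)
  rw [← Real.exp_mul, show -θ * logMean lam a u * (-1 / θ) = logMean lam a u by field_simp] at h1
  have h2 := mul_le_mul_of_nonneg_left h1 (Real.exp_nonneg (-logMean lam a u))
  rw [← Real.exp_add, neg_add_cancel, Real.exp_zero] at h2
  rw [pgf]
  linarith

theorem pgf_self (h : Admissible θ lam a) {s t : ℝ} (hs1 : s < 1) :
    pgf θ lam a s t t = s := by
  have h0 := h.theta_pos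
  have h1 : 0 < 1 - s := by linarith
  rw [pgf, survAux, sub_self, add_zero, Real.mul_rpow (Real.exp_nonneg _) (by positivity),
    ← Real.exp_mul, ← Real.rpow_mul h1.le, ← mul_assoc, ← Real.exp_add,
    show -logMean lam a t + -θ * logMean lam a t * (-1 / θ) = 0 by field_simp; ring,
    show -θ * (-1 / θ) = 1 by field_simp]
  simp

/-- The backward equation: the factor exp(-log μ_u) produces the linear term (a - 1)(1 - F), and the
power of `survAux` produces the term in (1 - F)^{1+θ}. -/
theorem hasACDeriv_pgf (h : Admissible θ lam a) {s t : ℝ} (hs : 0 ≤ s) (hs1 : s < 1)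
    (ht : 0 ≤ t) :
    HasACDeriv (pgf θ lam a s t)
      (fun u => -lam u * (offspringGF θ (a u) (pgf θ lam a s t u) - pgf θ lam a s t u)) 0 t := by
  have h0 := h.theta_pos
  have hpos : ∀ u ∈ uIcc 0 t, 0 < survAux θ lam a s t u := by
    intro u hu
    rw [uIcc_of_le ht] at hu
    exact h.survAux_pos hs hs1 hu.1 hu.2
  have hE := ((h.hasACDeriv_logMean ht).const_mul (-1)).exp
  have hY : HasACDeriv (survAux θ lam a s t)
      (fun u => 0 + (0 - θ / (1 + θ) * (Real.exp (-θ * logMean lam a u) * (a u * lam u)))) 0 t :=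
    (HasACDeriv.const (Real.exp (-θ * logMean lam a t) * (1 - s) ^ (-θ)) 0 t).add
      ((HasACDeriv.const (R θ lam a t) 0 t).sub (h.hasACDeriv_R ht))
  have hF := (HasACDeriv.const 1 0 t).sub (hE.mul (hY.rpow_const (-1 / θ) hpos))
  simp only [neg_mul, one_mul] at hF
  refine hF.congr_deriv fun u hu => ?_
  have hp := hpos u hu
  -- The exponent (-1/θ)(1 + θ) = -1/θ - 1 is the one created by differentiating the power -1/θ.
  have h2 : (1 - pgf θ lam a s t u) ^ (1 + θ)
      = Real.exp (-logMean lam a u) * Real.exp (-(θ * logMean lam a u))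
        * survAux θ lam a s t u ^ (-1 / θ - 1) := by
    rw [pgf, sub_sub_cancel, Real.mul_rpow (Real.exp_nonneg _) (by positivity), ← Real.exp_mul,
      ← Real.rpow_mul hp.le, ← Real.exp_add]
    congr 2
    · ring
    · field_simp
      ring
  rw [offspringGF, h2]
  simp only [pgf, sub_sub_cancel]
  field_simp
  ring

end Admissible

/-! ### The forward equation and its dual -/

section Forward

variable {Ω : Type*} {mΩ : MeasurableSpace Ω} {P : Measure Ω} {ℱ : Filtration ℝ≥0 mΩ}
  {lam : ℝ → ℝ} {p : ℝ → ℕ → ℝ} {Z : ℝ≥0 → Ω → ℕ}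

/-- Approximation of `x` from the right by multiples of `1 / (n + 1)`. -/
def gridRight (n : ℕ) (x : ℝ≥0) : ℝ≥0 := (⌊(n + 1) * x⌋₊ + 1 : ℕ) / (n + 1)

theorem lt_gridRight (n : ℕ) (x : ℝ≥0) : x < gridRight n x := by
  rw [gridRight, lt_div_iff₀ (by positivity), mul_comm]
  exact_mod_cast Nat.lt_floor_add_one ((n + 1) * x)

theorem gridRight_le (n : ℕ) (x : ℝ≥0) : gridRight n x ≤ x + 1 / (n + 1) := by
  rw [gridRight, Nat.cast_add, add_div, Nat.cast_one]
  gcongr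
  rw [div_le_iff₀ (by positivity), mul_comm]
  exact Nat.floor_le (zero_le)

theorem tendsto_gridRight (x : ℝ≥0) : Tendsto (fun n => gridRight n x) atTop (𝓝[≥] x) := by
  refine tendsto_nhdsWithin_iff.2 ⟨?_, .of_forall fun n => (lt_gridRight n x).le⟩
  refine tendsto_of_tendsto_of_tendsto_of_le_of_le tendsto_const_nhds ?_
    (fun n => (lt_gridRight n x).le) (fun n => gridRight_le n x)
  have : Tendsto (fun n : ℕ => (1 : ℝ≥0) / (n + 1)) atTop (𝓝 0) :=
    tendsto_one_div_add_atTop_nhds_zero_nat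
  simpa using this.const_add x

/-- A right-continuous process with values in `ℕ` is jointly measurable. -/
theorem measurable_uncurry_of_right_continuous (hmeas : ∀ t, Measurable (Z t))
    (hcont : ∀ ω t, ContinuousWithinAt (fun u => Z u ω) (Ici t) t) :
    Measurable fun q : ℝ≥0 × Ω => Z q.1 q.2 := by
  refine measurable_of_tendsto_metrizable
    (f := fun n (q : ℝ≥0 × Ω) => Z (gridRight n q.1) q.2) (fun n => ?_) ?_
  -- The grid time takes countably many values, so measurability at fixed times suffices.
  · have h1 : Measurable fun q : ℕ × Ω => Z ((q.1 + 1 : ℕ) / (n + 1)) q.2 :=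
      measurable_from_prod_countable_right fun k => by
        simpa using hmeas (((k + 1 : ℕ) : ℝ≥0) / (n + 1))
    exact h1.comp (((Nat.measurable_floor.comp (measurable_const.mul measurable_fst))).prodMk
      measurable_snd)
  · refine tendsto_pi_nhds.2 fun q => ?_
    exact (hcont q.2 q.1).tendsto.comp (tendsto_gridRight q.1)

/-- The generator applied to the indicator of `n`, divided by `lam`. -/
def jumpRate (p : ℝ → ℕ → ℝ) (n : ℕ) (u : ℝ) (m : ℕ) : ℝ :=
  m * ((if m - 1 ≤ n then p u (n - (m - 1)) else 0) - if m = n then 1 else 0)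

/-- Only the litter size k = n - (m - 1) leads from m to n. The truncated subtraction at m = 0 is
harmless because of the factor m. -/
theorem generator_single (n : ℕ) (u : ℝ) (m : ℕ) :
    generator lam p (fun j => if j = n then 1 else 0) u m = lam u * jumpRate p n u m := by
  have h1 : ∑' k, p u k * (if m - 1 + k = n then (1 : ℝ) else 0)
      = if m - 1 ≤ n then p u (n - (m - 1)) else 0 := by
    split_ifs with h
    · rw [tsum_eq_single (n - (m - 1))]
      · rw [if_pos (by omega), mul_one]
      · intro k hk
        rw [if_neg (by omega), mul_zero]
    · convert! tsum_zero with k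
      rw [if_neg (by omega), mul_zero]
  rw [generator, jumpRate, h1]
  ring

/-- Offspring laws `p u` with generating functions `g u`, measurable in time. -/
structure IsOffspringLaw (p : ℝ → ℕ → ℝ) (g : ℝ → ℝ → ℝ) : Prop where
  meas : ∀ k, Measurable fun u => p u k
  nonneg : ∀ u, 0 ≤ u → ∀ k, 0 ≤ p u k
  hasSum : ∀ u, 0 ≤ u → ∀ s, 0 ≤ s → s ≤ 1 → HasSum (fun k => p u k * s ^ k) (g u s)
  one : ∀ u, 0 ≤ u → g u 1 = 1

variable {g : ℝ → ℝ → ℝ}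

theorem IsOffspringLaw.le_one (hp : IsOffspringLaw p g) {u : ℝ} (hu : 0 ≤ u) (k : ℕ) :
    p u k ≤ 1 := by
  have := le_hasSum (hp.hasSum u hu 1 zero_le_one le_rfl) k
    fun j _ => by simpa using hp.nonneg u hu j
  simpa [hp.one u hu] using this

theorem measurable_jumpRate (hp : IsOffspringLaw p g) (n : ℕ) :
    Measurable fun q : ℝ × ℕ => jumpRate p n q.1 q.2 := by
  refine measurable_from_prod_countable_left fun m => ?_
  simp only [jumpRate]
  split_ifs
  · exact ((hp.meas _).sub_const _).const_mul _
  · exact ((hp.meas _).sub_const _).const_mul _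
  · exact measurable_const
  · exact measurable_const

/-- A jump lowers the population by at most one, so n can be reached only from m ≤ n + 1. Although
the total jump rate is unbounded in m, the flow into or out of a single state is bounded. -/
theorem abs_jumpRate_le (hp : IsOffspringLaw p g) (n : ℕ) {u : ℝ} (hu : 0 ≤ u) (m : ℕ) :
    |jumpRate p n u m| ≤ n + 1 := by
  rcases le_or_gt m (n + 1) with hm | hm
  · have h1 : |(if m - 1 ≤ n then p u (n - (m - 1)) else 0) - if m = n then (1 : ℝ) else 0| ≤ 1 := by
      have h2 := hp.le_one hu (n - (m - 1))
      have h3 := hp.nonneg u hu (n - (m - 1))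
      rw [abs_le]
      split_ifs <;> constructor <;> linarith
    rw [jumpRate, abs_mul, Nat.abs_cast]
    calc (m : ℝ) * _ ≤ (n + 1 : ℕ) * 1 := by gcongr
      _ = n + 1 := by push_cast; ring
  · rw [jumpRate, if_neg (by omega), if_neg (by omega)]
    simp only [sub_self, mul_zero, abs_zero]
    positivity

theorem measurable_uncurry_real (hZ : IsMarkovBranchingProcess P ℱ lam p Z) :
    Measurable fun q : ℝ × Ω => Z q.1.toNNReal q.2 :=
  (measurable_uncurry_of_right_continuous (fun t => (hZ.adapted t).mono (ℱ.le t) le_rfl)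
    hZ.right_continuous).comp ((measurable_real_toNNReal.comp measurable_fst).prodMk measurable_snd)

theorem measurable_state (hZ : IsMarkovBranchingProcess P ℱ lam p Z) (t : ℝ≥0) :
    Measurable (Z t) := (hZ.adapted t).mono (ℱ.le t) le_rfl

theorem integrable_of_bounded_comp (hZ : IsMarkovBranchingProcess P ℱ lam p Z) (t : ℝ≥0)
    (μ : Measure Ω) [IsFiniteMeasure μ] {f : ℕ → ℝ} {C : ℝ} (hf : ∀ n, |f n| ≤ C) :
    Integrable (fun ω => f (Z t ω)) μ :=
  Integrable.of_bound ((measurable_of_countable f).comp (measurable_state hZ t)).aestronglyMeasurable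
    C (.of_forall fun _ => hf _)

/-- Time derivative of the probability of state `n` on the event `B`. -/
def forwardRate (P : Measure Ω) (lam : ℝ → ℝ) (p : ℝ → ℕ → ℝ) (Z : ℝ≥0 → Ω → ℕ) (B : Set Ω)
    (n : ℕ) (u : ℝ) : ℝ :=
  ∫ ω in B, lam u * jumpRate p n u (Z u.toNNReal ω) ∂P

theorem integrable_rate_prod (hZ : IsMarkovBranchingProcess P ℱ lam p Z)
    (hp : IsOffspringLaw p g)
    {r t : ℝ} (hr : 0 ≤ r) (hrt : r ≤ t) (hlam : IntervalIntegrable lam volume r t)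
    (μ : Measure Ω) [IsFiniteMeasure μ] (n : ℕ) :
    Integrable (fun q : ℝ × Ω => lam q.1 * jumpRate p n q.1 (Z q.1.toNNReal q.2))
      ((volume.restrict (Ioc r t)).prod μ) := by
  rw [intervalIntegrable_iff, uIoc_of_le hrt] at hlam
  have h1 : Integrable (fun q : ℝ × Ω => lam q.1) ((volume.restrict (Ioc r t)).prod μ) :=
    Integrable.comp_fst hlam μ
  have h2 : Measurable fun q : ℝ × Ω => jumpRate p n q.1 (Z q.1.toNNReal q.2) :=
    (measurable_jumpRate hp n).comp (measurable_fst.prodMk (measurable_uncurry_real hZ))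
  refine h1.mul_bdd (c := n + 1) h2.aestronglyMeasurable ?_
  have h3 : ∀ᵐ q ∂(volume.restrict (Ioc r t)).prod μ, q.1 ∈ Ioc r t :=
    Measure.quasiMeasurePreserving_fst.ae (ae_restrict_mem measurableSet_Ioc)
  filter_upwards [h3] with q hq
  exact abs_jumpRate_le hp n (hr.trans hq.1.le) _

theorem integrable_rate_path (hZ : IsMarkovBranchingProcess P ℱ lam p Z)
    (hp : IsOffspringLaw p g)
    {r t : ℝ} (hr : 0 ≤ r) (hrt : r ≤ t) (hlam : IntervalIntegrable lam volume r t)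
    (n : ℕ) (ω : Ω) :
    IntervalIntegrable (fun u => lam u * jumpRate p n u (Z u.toNNReal ω)) volume r t := by
  rw [intervalIntegrable_iff, uIoc_of_le hrt] at hlam ⊢
  have h2 : Measurable fun u : ℝ => jumpRate p n u (Z u.toNNReal ω) :=
    (measurable_jumpRate hp n).comp (measurable_id.prodMk
      ((measurable_uncurry_real hZ).comp (measurable_id.prodMk measurable_const)))
  refine Integrable.mul_bdd (c := n + 1) hlam h2.aestronglyMeasurable ?_
  filter_upwards [ae_restrict_mem measurableSet_Ioc] with u hu
  exact abs_jumpRate_le hp n (hr.trans hu.1.le) _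

theorem intervalIntegrable_forwardRate [IsProbabilityMeasure P]
    (hZ : IsMarkovBranchingProcess P ℱ lam p Z)
    (hp : IsOffspringLaw p g)
    {r t : ℝ} (hr : 0 ≤ r) (hrt : r ≤ t) (hlam : IntervalIntegrable lam volume r t)
    (B : Set Ω) (n : ℕ) :
    IntervalIntegrable (forwardRate P lam p Z B n) volume r t := by
  rw [intervalIntegrable_iff, uIoc_of_le hrt]
  exact (integrable_rate_prod hZ hp hr hrt hlam (P.restrict B) n).integral_prod_left

/-- The Kolmogorov forward equation, in integrated form. -/
theorem forward_equation [IsProbabilityMeasure P]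
    (hZ : IsMarkovBranchingProcess P ℱ lam p Z) (hp : IsOffspringLaw p g)
    (hlam : ∀ t, 0 ≤ t → IntervalIntegrable lam volume 0 t)
    {r t : ℝ≥0} (hrt : r ≤ t) {B : Set Ω} (hB : MeasurableSet[ℱ r] B) (n : ℕ) :
    ∫ ω in B, (if Z t ω = n then (1 : ℝ) else 0) ∂P
      = (∫ ω in B, (if Z r ω = n then (1 : ℝ) else 0) ∂P)
        + ∫ u in (r : ℝ)..t, forwardRate P lam p Z B n u := by
  have hrt' : (r : ℝ) ≤ t := hrt
  have h0t := hlam t t.2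
  have hlr : IntervalIntegrable lam volume 0 r := hlam r r.2
  have hlrt : IntervalIntegrable lam volume r t := hlr.symm.trans h0t
  have hmart := hZ.martingale (fun j => if j = n then 1 else 0)
    ((finite_singleton n).subset fun j hj => by
      by_contra hne
      exact hj (if_neg hne))
  simp only [generator_single] at hmart
  have hind : ∀ v : ℝ≥0, Integrable (fun ω => if Z v ω = n then (1 : ℝ) else 0) P := fun v =>
    integrable_of_bounded_comp hZ v P (f := fun j => if j = n then (1 : ℝ) else 0) (C := 1)
      fun j => by split_ifs <;> simp
  -- The compensator is the difference of a bounded variable and the martingale.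
  have hint : ∀ v : ℝ≥0, Integrable
      (fun ω => ∫ u in (0 : ℝ)..v, lam u * jumpRate p n u (Z u.toNNReal ω)) P := fun v => by
    convert! (hind v).sub (hmart.integrable v) using 1
    funext ω
    simp
  have heq := hmart.setIntegral_eq hrt hB
  rw [integral_sub (hind r).integrableOn (hint r).integrableOn,
    integral_sub (hind t).integrableOn (hint t).integrableOn] at heq
  have hsplit : (∫ ω in B, (∫ u in (0 : ℝ)..t, lam u * jumpRate p n u (Z u.toNNReal ω)) ∂P)
      - (∫ ω in B, (∫ u in (0 : ℝ)..r, lam u * jumpRate p n u (Z u.toNNReal ω)) ∂P)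
      = ∫ ω in B, (∫ u in (r : ℝ)..t, lam u * jumpRate p n u (Z u.toNNReal ω)) ∂P := by
    rw [← integral_sub (hint t).integrableOn (hint r).integrableOn]
    refine integral_congr_ae (.of_forall fun ω => ?_)
    exact intervalIntegral.integral_interval_sub_left
      (integrable_rate_path hZ hp le_rfl t.2 h0t n ω)
      (integrable_rate_path hZ hp le_rfl r.2 hlr n ω)
  have hswap : ∫ ω in B, (∫ u in (r : ℝ)..t, lam u * jumpRate p n u (Z u.toNNReal ω)) ∂P
      = ∫ u in (r : ℝ)..t, forwardRate P lam p Z B n u := by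
    simp only [intervalIntegral.integral_of_le hrt', forwardRate]
    exact (integral_integral_swap
      (f := fun u ω => lam u * jumpRate p n u (Z u.toNNReal ω))
      (integrable_rate_prod hZ hp r.2 hrt' hlrt (P.restrict B) n)).symm
  linarith

end Forward

/-! ### Duality between the forward and the backward equation -/

section Duality

variable {Ω : Type*} {mΩ : MeasurableSpace Ω} {P : Measure Ω} {ℱ : Filtration ℝ≥0 mΩ}
  {lam : ℝ → ℝ} {p : ℝ → ℕ → ℝ} {Z : ℝ≥0 → Ω → ℕ} {g : ℝ → ℝ → ℝ}

theorem hasSum_shifted_offspring (hp : IsOffspringLaw p g) {u s : ℝ} (hu : 0 ≤ u) (hs : 0 ≤ s)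
    (hs1 : s ≤ 1) (k : ℕ) :
    HasSum (fun n => (if k ≤ n then p u (n - k) else 0) * s ^ n) (s ^ k * g u s) := by
  have h1 := (hasSum_nat_add_iff (f := fun n => (if k ≤ n then p u (n - k) else 0) * s ^ n)
    (g := s ^ k * g u s) k).1 (by
      convert! (hp.hasSum u hu s hs hs1).mul_left (s ^ k) using 2 with n
      rw [if_pos (by omega), Nat.add_sub_cancel, pow_add]
      ring)
  rwa [Finset.sum_eq_zero, add_zero] at h1
  intro n hn
  rw [if_neg (by simpa using hn), zero_mul]

theorem gf_le_one (hp : IsOffspringLaw p g) {u s : ℝ} (hu : 0 ≤ u) (hs : 0 ≤ s) (hs1 : s ≤ 1) :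
    g u s ≤ 1 := by
  have h1 := hp.hasSum u hu 1 zero_le_one le_rfl
  rw [hp.one u hu] at h1
  refine hasSum_le (fun k => ?_) (hp.hasSum u hu s hs hs1) h1
  rw [one_pow]
  exact mul_le_mul_of_nonneg_left (pow_le_one₀ hs hs1) (hp.nonneg u hu k)

theorem sum_jumpRate_mul_pow (N : ℕ) (u s : ℝ) (m : ℕ) :
    ∑ n ∈ Finset.range N, jumpRate p n u m * s ^ n
      = m * ((∑ n ∈ Finset.range N, (if m - 1 ≤ n then p u (n - (m - 1)) else 0) * s ^ n)
        - if m < N then s ^ m else 0) := by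
  simp only [jumpRate, mul_sub, sub_mul, Finset.sum_sub_distrib, Finset.mul_sum, mul_assoc]
  congr 1
  rw [← Finset.mul_sum]
  simp [ite_mul, Finset.sum_ite_eq]

/-- Each of the m terms of the geometric sum is at least s^{m-1}. This bound, uniform in m, stands
in for a moment bound on Z, which is not yet available. -/
theorem nat_mul_pow_le {s ρ : ℝ} (hs : 0 ≤ s) (hsρ : s ≤ ρ) (hρ : ρ < 1) (m : ℕ) :
    m * s ^ (m - 1) ≤ (1 - ρ)⁻¹ := by
  have hs1 : s < 1 := hsρ.trans_lt hρ
  have h1 : (m : ℝ) * s ^ (m - 1) ≤ ∑ i ∈ Finset.range m, s ^ i := by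
    rw [← nsmul_eq_mul]
    have := Finset.card_nsmul_le_sum (Finset.range m) (fun i => s ^ i) (s ^ (m - 1)) fun i hi =>
      pow_le_pow_of_le_one hs hs1.le (by have := Finset.mem_range.1 hi; omega)
    simpa using this
  have h2 : ∑ i ∈ Finset.range m, s ^ i ≤ ∑' i, s ^ i :=
    (summable_geometric_of_lt_one hs hs1).sum_le_tsum _ fun i _ => pow_nonneg hs i
  rw [tsum_geometric_of_lt_one hs hs1] at h2
  refine h1.trans (h2.trans ?_)
  gcongr

/-- The space-time generator applied to the truncation to `n < N` of `(u, n) ↦ F u ^ n`, where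
`s = F u`, `s' = F' u` and `l = lam u`. -/
def truncGen (p : ℝ → ℕ → ℝ) (N : ℕ) (u l s s' : ℝ) (m : ℕ) : ℝ :=
  ∑ n ∈ Finset.range N, (l * jumpRate p n u m * s ^ n
    + (if m = n then 1 else 0) * (n * s ^ (n - 1) * s'))

theorem truncGen_eq (N : ℕ) (u l s s' : ℝ) (m : ℕ) :
    truncGen p N u l s s' m = l * (m
      * ((∑ n ∈ Finset.range N, (if m - 1 ≤ n then p u (n - (m - 1)) else 0) * s ^ n)
        - if m < N then s ^ m else 0)) + if m < N then m * s ^ (m - 1) * s' else 0 := by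
  rw [truncGen, Finset.sum_add_distrib, ← sum_jumpRate_mul_pow, Finset.mul_sum]
  congr 1
  · exact Finset.sum_congr rfl fun n _ => mul_assoc _ _ _
  · simp [ite_mul, Finset.sum_ite_eq]

/-- The truncated gain sum and the loss term both lie in [0, s^{m-1}], so their difference does not
exceed s^{m-1}, and m s^{m-1} is bounded. -/
theorem abs_truncGen_le (hp : IsOffspringLaw p g) {u l s s' ρ : ℝ} (hu : 0 ≤ u) (hl : 0 ≤ l)
    (hs : 0 ≤ s) (hsρ : s ≤ ρ) (hρ : ρ < 1) (N m : ℕ) :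
    |truncGen p N u l s s' m| ≤ (1 - ρ)⁻¹ * (l + |s'|) := by
  have hs1 : s ≤ 1 := (hsρ.trans_lt hρ).le
  have hsum := hasSum_shifted_offspring hp hu hs hs1 (m - 1)
  have hnn : ∀ n, 0 ≤ (if m - 1 ≤ n then p u (n - (m - 1)) else 0) * s ^ n := fun n => by
    have := hp.nonneg u hu (n - (m - 1))
    split_ifs <;> positivity
  have h1 := sum_le_hasSum (Finset.range N) (fun n _ => hnn n) hsum
  have h2 := Finset.sum_nonneg (s := Finset.range N) fun n _ => hnn n
  have h3 : s ^ (m - 1) * g u s ≤ s ^ (m - 1) :=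
    mul_le_of_le_one_right (pow_nonneg hs _) (gf_le_one hp hu hs hs1)
  have h4 : s ^ m ≤ s ^ (m - 1) := pow_le_pow_of_le_one hs hs1 (Nat.sub_le m 1)
  have h5 := pow_nonneg hs m
  have h6 := nat_mul_pow_le hs hsρ hρ m
  have h7 := pow_nonneg hs (m - 1)
  rw [truncGen_eq]
  set S := ∑ n ∈ Finset.range N, (if m - 1 ≤ n then p u (n - (m - 1)) else 0) * s ^ n
  have h8 : |S - if m < N then s ^ m else 0| ≤ s ^ (m - 1) := by
    rw [abs_le]
    split_ifs <;> constructor <;> linarith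
  have h9 : |if m < N then (m : ℝ) * s ^ (m - 1) * s' else 0| ≤ m * s ^ (m - 1) * |s'| := by
    split_ifs
    · rw [abs_mul, abs_of_nonneg (by positivity)]
    · rw [abs_zero]
      positivity
  calc _ ≤ l * (m * |S - if m < N then s ^ m else 0|) + m * s ^ (m - 1) * |s'| := by
        refine (abs_add_le _ _).trans (add_le_add ?_ h9)
        rw [abs_mul, abs_mul, abs_of_nonneg hl, Nat.abs_cast]
    _ ≤ l * (m * s ^ (m - 1)) + m * s ^ (m - 1) * |s'| := by gcongr
    _ = m * s ^ (m - 1) * (l + |s'|) := by ring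
    _ ≤ _ := by gcongr

/-- Without truncation the value is m s^{m-1} (l (g(s) - s) + s'), which vanishes by the backward
equation. -/
theorem tendsto_truncGen (hp : IsOffspringLaw p g) {u l s s' : ℝ} (hu : 0 ≤ u)
    (hs : 0 ≤ s) (hs1 : s ≤ 1) (hs' : s' = -l * (g u s - s)) (m : ℕ) :
    Tendsto (fun N => truncGen p N u l s s' m) atTop (𝓝 0) := by
  have hsum := (hasSum_shifted_offspring hp hu hs hs1 (m - 1)).tendsto_sum_nat
  have h1 : Tendsto (fun N => l * (m
      * ((∑ n ∈ Finset.range N, (if m - 1 ≤ n then p u (n - (m - 1)) else 0) * s ^ n)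
        - s ^ m)) + m * s ^ (m - 1) * s') atTop
      (𝓝 (l * (m * (s ^ (m - 1) * g u s - s ^ m)) + m * s ^ (m - 1) * s')) :=
    (((hsum.sub_const _).const_mul _).const_mul _).add_const _
  have h2 : l * (m * (s ^ (m - 1) * g u s - s ^ m)) + m * s ^ (m - 1) * s' = 0 := by
    rw [hs']
    rcases m with _ | m
    · simp
    · rw [Nat.add_sub_cancel, pow_succ]
      ring
  rw [h2] at h1
  refine h1.congr' ?_
  filter_upwards [eventually_gt_atTop m] with N hN
  rw [truncGen_eq, if_pos hN, if_pos hN]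

/-- If `F` solves the backward equation on `[r, t]`, then `u ↦ F u ^ Z u` has constant expectation
on each event in the past of `r`. -/
theorem duality [IsProbabilityMeasure P] (hZ : IsMarkovBranchingProcess P ℱ lam p Z)
    (hp : IsOffspringLaw p g)
    (hlam0 : ∀ t, 0 ≤ t → 0 ≤ lam t) (hlam : ∀ t, 0 ≤ t → IntervalIntegrable lam volume 0 t)
    {r t : ℝ≥0} (hrt : r ≤ t) {B : Set Ω} (hB : MeasurableSet[ℱ r] B) {F : ℝ → ℝ}
    (hF : HasACDeriv F (fun u => -lam u * (g u (F u) - F u)) r t)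
    (hF0 : ∀ u ∈ Icc (r : ℝ) t, 0 ≤ F u) (hF1 : ∀ u ∈ Icc (r : ℝ) t, F u < 1) :
    ∫ ω in B, F t ^ Z t ω ∂P = ∫ ω in B, F r ^ Z r ω ∂P := by
  have hrt' : (r : ℝ) ≤ t := hrt
  have hlrt : IntervalIntegrable lam volume r t := (hlam r r.2).symm.trans (hlam t t.2)
  set F' := fun u => -lam u * (g u (F u) - F u) with hF'
  -- The maximum of F over the compact interval is still below 1; it serves as ρ in the bounds,
  -- uniformly in time.
  obtain ⟨v, hv, hvmax⟩ := isCompact_Icc.exists_isMaxOn (nonempty_Icc.2 hrt')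
    (by simpa [uIcc_of_le hrt'] using hF.continuousOn)
  have hρ : ∀ u ∈ Icc (r : ℝ) t, F u ≤ F v := fun u hu => hvmax hu
  have hρ1 := hF1 v hv
  have hind : ∀ (u : ℝ≥0) (n : ℕ),
      Integrable (fun ω => if Z u ω = n then (1 : ℝ) else 0) (P.restrict B) := fun u n =>
    integrable_of_bounded_comp hZ u _ (f := fun j => if j = n then (1 : ℝ) else 0) (C := 1)
      fun j => by split_ifs <;> simp
  set q : ℕ → ℝ → ℝ := fun n u => (∫ ω in B, (if Z r ω = n then (1 : ℝ) else 0) ∂P)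
    + ∫ x in (r : ℝ)..u, forwardRate P lam p Z B n x with hq
  have hq_eq : ∀ n, ∀ u ∈ Icc (r : ℝ) t,
      q n u = ∫ ω in B, (if Z u.toNNReal ω = n then (1 : ℝ) else 0) ∂P := fun n u hu => by
    have hu0 : (0 : ℝ) ≤ u := r.2.trans hu.1
    rw [forward_equation hZ hp hlam (NNReal.le_toNNReal_of_coe_le hu.1) hB n,
      Real.coe_toNNReal u hu0]
  have hqAC : ∀ n, HasACDeriv (q n) (forwardRate P lam p Z B n) r t := fun n =>
    ((HasACDeriv.const _ _ _).add ((intervalIntegrable_forwardRate hZ hp r.2 hrt' hlrt B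
      n).hasACDeriv left_mem_uIcc)).congr_deriv fun u _ => zero_add _
  have hD : ∀ N, ∫ u in (r : ℝ)..t,
      ∑ n ∈ Finset.range N, (forwardRate P lam p Z B n u * F u ^ n
        + q n u * (n * F u ^ (n - 1) * F' u))
      = (∑ n ∈ Finset.range N, q n t * F t ^ n) - ∑ n ∈ Finset.range N, q n r * F r ^ n :=
    fun N => (HasACDeriv.sum (Finset.range N)
      fun n _ => (hqAC n).mul (hF.pow n)).integral_eq_sub
  have hK : ∀ N, ∀ u ∈ Icc (r : ℝ) t,
      ∑ n ∈ Finset.range N, (forwardRate P lam p Z B n u * F u ^ n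
        + q n u * (n * F u ^ (n - 1) * F' u))
      = ∫ ω in B, truncGen p N u (lam u) (F u) (F' u) (Z u.toNNReal ω) ∂P := by
    intro N u hu
    have hu0 : (0 : ℝ) ≤ u := r.2.trans hu.1
    have hjump : ∀ n, Integrable
        (fun ω => lam u * jumpRate p n u (Z u.toNNReal ω) * F u ^ n) (P.restrict B) := fun n =>
      ((integrable_of_bounded_comp hZ u.toNNReal _ fun m =>
        abs_jumpRate_le hp n hu0 m).const_mul (lam u)).mul_const _
    have hI := fun n => (hind u.toNNReal n).mul_const (n * F u ^ (n - 1) * F' u)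
    simp only [truncGen]
    refine Eq.trans ?_ (integral_finsetSum _ fun n _ => (hjump n).add (hI n)).symm
    refine Finset.sum_congr rfl fun n _ => ?_
    refine Eq.trans ?_ (integral_add (hjump n) (hI n)).symm
    rw [integral_mul_const, integral_mul_const, hq_eq n u hu, forwardRate]
  -- Dominated convergence is used twice with the same bound: over ω at fixed u, then over u.
  have hlim0 : Tendsto (fun N => ∫ u in (r : ℝ)..t,
      ∑ n ∈ Finset.range N, (forwardRate P lam p Z B n u * F u ^ n
        + q n u * (n * F u ^ (n - 1) * F' u))) atTop (𝓝 (∫ _ in (r : ℝ)..t, (0 : ℝ))) := by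
    refine intervalIntegral.tendsto_integral_filter_of_dominated_convergence
      (fun u => (1 - F v)⁻¹ * (lam u + |F' u|)) (.of_forall fun N => ?_)
      (.of_forall fun N => .of_forall fun u hu => ?_)
      ((hlrt.add hF.intervalIntegrable.abs).const_mul _) (.of_forall fun u hu => ?_)
    · exact (HasACDeriv.sum (Finset.range N)
        fun n _ => (hqAC n).mul (hF.pow n)).intervalIntegrable.aestronglyMeasurable_restrict_uIoc
    · rw [uIoc_of_le hrt'] at hu
      have hu' : u ∈ Icc (r : ℝ) t := Ioc_subset_Icc_self hu
      have hu0 : (0 : ℝ) ≤ u := r.2.trans hu'.1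
      rw [hK N u hu']
      have hb : 0 ≤ (1 - F v)⁻¹ * (lam u + |F' u|) := by
        have h1 := hlam0 u hu0
        have h2 : 0 < 1 - F v := by linarith
        positivity
      refine (norm_integral_le_of_norm_le_const (.of_forall fun ω =>
        abs_truncGen_le hp hu0 (hlam0 u hu0) (hF0 u hu') (hρ u hu') hρ1 N _)).trans ?_
      exact mul_le_of_le_one_right hb ((measureReal_mono (subset_univ _)).trans
        (by rw [measureReal_restrict_apply_univ]; exact measureReal_le_one))
    · rw [uIoc_of_le hrt'] at hu
      have hu' : u ∈ Icc (r : ℝ) t := Ioc_subset_Icc_self hu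
      have hu0 : (0 : ℝ) ≤ u := r.2.trans hu'.1
      simp only [hK _ u hu']
      rw [← integral_zero Ω ℝ (μ := P.restrict B)]
      refine tendsto_integral_of_dominated_convergence
        (fun _ => (1 - F v)⁻¹ * (lam u + |F' u|)) (fun N => ?_) (integrable_const _)
        (fun N => .of_forall fun ω => ?_) (.of_forall fun ω => ?_)
      · exact ((measurable_of_countable (truncGen p N u (lam u) (F u) (F' u))).comp
          (measurable_state hZ u.toNNReal)).aestronglyMeasurable
      · exact abs_truncGen_le hp hu0 (hlam0 u hu0) (hF0 u hu') (hρ u hu') hρ1 N _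
      · exact tendsto_truncGen hp hu0 (hF0 u hu') (hF1 u hu').le rfl _
  have hend : ∀ u : ℝ≥0, (u : ℝ) ∈ Icc (r : ℝ) t →
      Tendsto (fun N => ∑ n ∈ Finset.range N, q n u * F u ^ n) atTop
        (𝓝 (∫ ω in B, F u ^ Z u ω ∂P)) := by
    intro u hu
    have h1 : ∀ N, ∑ n ∈ Finset.range N, q n u * F u ^ n
        = ∫ ω in B, (if Z u ω < N then F u ^ Z u ω else 0) ∂P := fun N => by
      have h2 : ∀ ω, (if Z u ω < N then F u ^ Z u ω else 0)
          = ∑ n ∈ Finset.range N, (if Z u ω = n then (1 : ℝ) else 0) * F u ^ n := fun ω => by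
        simp [ite_mul, Finset.sum_ite_eq]
      simp only [h2]
      rw [integral_finsetSum _ fun n _ => (hind u n).mul_const _]
      refine Finset.sum_congr rfl fun n _ => ?_
      rw [integral_mul_const, hq_eq n u hu, Real.toNNReal_coe]
    simp only [h1]
    refine tendsto_integral_of_dominated_convergence (fun _ => 1) (fun N => ?_)
      (integrable_const _) (fun N => .of_forall fun ω => ?_) (.of_forall fun ω => ?_)
    · exact ((measurable_of_countable fun m => if m < N then F u ^ m else 0).comp
          (measurable_state hZ u)).aestronglyMeasurable
    · split_ifs
      · rw [norm_pow, Real.norm_of_nonneg (hF0 u hu)]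
        exact pow_le_one₀ (hF0 u hu) (hF1 u hu).le
      · simp
    · refine tendsto_const_nhds.congr' ?_
      filter_upwards [eventually_gt_atTop (Z u ω)] with N hN
      rw [if_pos hN]
  simp only [hD, intervalIntegral.integral_zero] at hlim0
  have := tendsto_nhds_unique hlim0
    ((hend t (right_mem_Icc.2 hrt')).sub (hend r (left_mem_Icc.2 hrt')))
  linarith

end Duality

/-! ### Generating function and mean of the theta-positive process -/

section ThetaPositive

theorem Admissible.isOffspringLaw {θ : ℝ} {lam a : ℝ → ℝ} (h : Admissible θ lam a) :
    IsOffspringLaw (fun t => offspring θ (a t)) (fun t => offspringGF θ (a t)) where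
  meas k := by
    have := h.meas
    match k with
    | 0 => simp only [offspring]; fun_prop
    | 1 => simp only [offspring]; fun_prop
    | n + 2 => simp only [offspring]; fun_prop
  nonneg u hu := offspring_nonneg h.theta_pos h.theta_le_one (h.nonneg u hu) (h.le u hu)
  hasSum u hu s hs hs1 :=
    hasSum_offspring h.theta_pos h.theta_le_one (h.nonneg u hu) (h.le u hu) hs hs1
  one u _ := by
    have := h.theta_pos
    simp [offspringGF, Real.zero_rpow (by positivity : (1 + θ) ≠ 0)]

/-- Pulling out x leaves a factor with a limit at x = 0. It serves with x = 1 - s for the mean of Z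
and with x = w for the mean of W. -/
theorem rpow_neg_inv_add {θ x A D : ℝ} (hθ : 0 < θ) (hx : 0 < x) (hA : 0 ≤ A) (hD : 0 ≤ D) :
    (A * x ^ (-θ) + D) ^ (-1 / θ) = x * (A + D * x ^ θ) ^ (-1 / θ) := by
  have h1 : A * x ^ (-θ) + D = x ^ (-θ) * (A + D * x ^ θ) := by
    have : x ^ (-θ) * x ^ θ = 1 := by rw [← Real.rpow_add hx, neg_add_cancel, Real.rpow_zero]
    linear_combination (-D) * this
  rw [h1, Real.mul_rpow (by positivity) (by positivity), ← Real.rpow_mul hx.le,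
    show -θ * (-1 / θ) = 1 by field_simp, Real.rpow_one]

theorem tendsto_rpow_neg_inv_add {θ A D : ℝ} (hθ : 0 < θ) (hA : 0 < A) :
    Tendsto (fun x : ℝ => (A + D * x ^ θ) ^ (-1 / θ)) (𝓝[>] 0) (𝓝 (A ^ (-1 / θ))) := by
  have h1 : Tendsto (fun x : ℝ => x ^ θ) (𝓝[>] 0) (𝓝 0) := by
    have := (Real.continuousAt_rpow_const (0 : ℝ) θ (Or.inr hθ.le)).tendsto
    rw [Real.zero_rpow hθ.ne'] at this
    exact this.mono_left nhdsWithin_le_nhds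
  have h2 : Tendsto (fun x : ℝ => A + D * x ^ θ) (𝓝[>] 0) (𝓝 A) := by
    simpa using (h1.const_mul D).const_add A
  exact h2.rpow_const (Or.inl hA.ne')

variable {θ : ℝ} {lam a : ℝ → ℝ}

theorem logMean_zero : logMean lam a 0 = 0 := by simp [logMean]

theorem R_zero : R θ lam a 0 = 0 := by simp [R, V', logMean_zero]

theorem Admissible.R_nonneg (h : Admissible θ lam a) {t : ℝ} (ht : 0 ≤ t) : 0 ≤ R θ lam a t := by
  simpa [R_zero] using h.R_mono le_rfl ht

theorem Admissible.one_sub_pgf (h : Admissible θ lam a) {s r t : ℝ} (hs1 : s < 1) (hr : 0 ≤ r)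
    (hrt : r ≤ t) :
    1 - pgf θ lam a s t r = (1 - s) * (Real.exp (-logMean lam a r)
      * (Real.exp (-θ * logMean lam a t) + (R θ lam a t - R θ lam a r) * (1 - s) ^ θ)
        ^ (-1 / θ)) := by
  rw [pgf, survAux, rpow_neg_inv_add h.theta_pos (by linarith) (Real.exp_nonneg _)
    (by linarith [h.R_mono hr hrt])]
  ring

/-- A sequence in `[0, 1)` increasing to `1`. -/
def toOne (k : ℕ) : ℝ := 1 - 1 / (k + 1)

theorem toOne_nonneg (k : ℕ) : 0 ≤ toOne k := by
  rw [toOne, sub_nonneg, div_le_one (by positivity)]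
  linarith [k.cast_nonneg (α := ℝ)]

theorem toOne_lt_one (k : ℕ) : toOne k < 1 := by
  have : (0 : ℝ) < 1 / (k + 1) := by positivity
  rw [toOne]
  linarith

theorem tendsto_one_sub_toOne : Tendsto (fun k => 1 - toOne k) atTop (𝓝[>] 0) := by
  refine tendsto_nhdsWithin_iff.2 ⟨?_, .of_forall fun k => by
    simpa using toOne_lt_one k⟩
  simpa [toOne] using tendsto_one_div_add_atTop_nhds_zero_nat (𝕜 := ℝ)

theorem tendsto_toOne : Tendsto toOne atTop (𝓝 1) := by
  have := (tendsto_one_sub_toOne.mono_right nhdsWithin_le_nhds).const_sub 1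
  simpa using this

/-- The limit is the left derivative at s = 1 of the generating function, hence the conditional mean
μ_t / μ_r of one individual's progeny. -/
theorem Admissible.tendsto_survival_ratio (h : Admissible θ lam a) {r t : ℝ} (hr : 0 ≤ r)
    (hrt : r ≤ t) :
    Tendsto (fun k => (1 - pgf θ lam a (toOne k) t r) / (1 - toOne k)) atTop
      (𝓝 (Real.exp (logMean lam a t - logMean lam a r))) := by
  have h0 := h.theta_pos
  have h1 := ((tendsto_rpow_neg_inv_add (D := R θ lam a t - R θ lam a r) h.theta_pos
    (Real.exp_pos (-θ * logMean lam a t))).comp tendsto_one_sub_toOne).const_mul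
      (Real.exp (-logMean lam a r))
  have h2 : Real.exp (-logMean lam a r) * Real.exp (-θ * logMean lam a t) ^ (-1 / θ)
      = Real.exp (logMean lam a t - logMean lam a r) := by
    rw [← Real.exp_mul, ← Real.exp_add]
    congr 1
    field_simp
    ring
  rw [h2] at h1
  refine h1.congr fun k => ?_
  have hk : 1 - toOne k ≠ 0 := by linarith [toOne_lt_one k]
  rw [h.one_sub_pgf (toOne_lt_one k) hr hrt, mul_div_cancel_left₀ _ hk]
  rfl

theorem Admissible.tendsto_pgf_toOne (h : Admissible θ lam a) {r t : ℝ} (hr : 0 ≤ r)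
    (hrt : r ≤ t) :
    Tendsto (fun k => pgf θ lam a (toOne k) t r) atTop (𝓝 1) := by
  have h1 := (tendsto_one_sub_toOne.mono_right nhdsWithin_le_nhds).mul
    (h.tendsto_survival_ratio hr hrt)
  rw [zero_mul] at h1
  have h2 := h1.const_sub 1
  rw [sub_zero] at h2
  refine h2.congr fun k => ?_
  have hk : 1 - toOne k ≠ 0 := by linarith [toOne_lt_one k]
  field_simp
  ring

variable {Ω : Type*} {mΩ : MeasurableSpace Ω} {P : Measure Ω}
  {ℱ : Filtration ℝ≥0 mΩ} {Z : ℝ≥0 → Ω → ℕ}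

/-- The conditional generating function of the process. -/
theorem setIntegral_pow [IsProbabilityMeasure P] (h : Admissible θ lam a)
    (hZ : IsMarkovBranchingProcess P ℱ lam (fun t => offspring θ (a t)) Z)
    {r t : ℝ≥0} (hrt : r ≤ t) {B : Set Ω} (hB : MeasurableSet[ℱ r] B) {s : ℝ} (hs : 0 ≤ s)
    (hs1 : s < 1) :
    ∫ ω in B, s ^ Z t ω ∂P = ∫ ω in B, pgf θ lam a s t r ^ Z r ω ∂P := by
  have hrt' : (r : ℝ) ≤ t := hrt
  rw [← duality hZ h.isOffspringLaw h.rate_nonneg h.rate_integrable hrt hB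
    ((h.hasACDeriv_pgf hs hs1 t.coe_nonneg).mono (by
      rw [uIcc_of_le hrt', uIcc_of_le t.coe_nonneg]
      exact Icc_subset_Icc_left r.coe_nonneg))
    (fun u hu => h.pgf_nonneg hs hs1 (r.2.trans hu.1) hu.2)
    (fun u hu => h.pgf_lt_one hs hs1 (r.2.trans hu.1) hu.2), h.pgf_self hs1]

/-- The generating function of the process. -/
theorem integral_pow [IsProbabilityMeasure P] (h : Admissible θ lam a)
    (hZ : IsMarkovBranchingProcess P ℱ lam (fun t => offspring θ (a t)) Z)
    (t : ℝ≥0) {s : ℝ} (hs : 0 ≤ s) (hs1 : s < 1) :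
    ∫ ω, s ^ Z t ω ∂P = pgf θ lam a s t 0 := by
  have := setIntegral_pow h hZ (zero_le : (0 : ℝ≥0) ≤ t) (B := univ) MeasurableSet.univ hs hs1
  simpa [hZ.start] using this

theorem integral_pow_eq [IsProbabilityMeasure P] (h : Admissible θ lam a)
    (hZ : IsMarkovBranchingProcess P ℱ lam (fun t => offspring θ (a t)) Z)
    (t : ℝ≥0) {s : ℝ} (hs : 0 ≤ s) (hs1 : s < 1) :
    ∫ ω, s ^ Z t ω ∂P
      = 1 - (Real.exp (-θ * logMean lam a t) * (1 - s) ^ (-θ) + R θ lam a t) ^ (-1 / θ) := by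
  rw [integral_pow h hZ t hs hs1, pgf, survAux, logMean_zero, R_zero]
  simp

theorem geom_sum_le_card {s : ℝ} (hs : 0 ≤ s) (hs1 : s < 1) (n : ℕ) :
    ∑ i ∈ Finset.range n, s ^ i ≤ n := by
  have := Finset.sum_le_card_nsmul (Finset.range n) (fun i => s ^ i) 1
    fun i _ => pow_le_one₀ hs hs1.le
  simpa using this

theorem integrable_pow (hZ : IsMarkovBranchingProcess P ℱ lam (fun t => offspring θ (a t)) Z)
    (t : ℝ≥0) (μ : Measure Ω) [IsFiniteMeasure μ] {s : ℝ} (hs : 0 ≤ s) (hs1 : s < 1) :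
    Integrable (fun ω => s ^ Z t ω) μ :=
  integrable_of_bounded_comp hZ t μ (f := fun n => s ^ n) (C := 1) fun n => by
    rw [abs_of_nonneg (pow_nonneg hs n)]
    exact pow_le_one₀ hs hs1.le

theorem geom_sum_eq_div {s : ℝ} (hs1 : s < 1) (n : ℕ) :
    ∑ i ∈ Finset.range n, s ^ i = (1 - s ^ n) / (1 - s) := by
  have h1 : 1 - s ≠ 0 := by linarith
  rw [eq_div_iff h1, geom_sum_mul_neg]

theorem integrable_geom_sum
    (hZ : IsMarkovBranchingProcess P ℱ lam (fun t => offspring θ (a t)) Z)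
    (t : ℝ≥0) (μ : Measure Ω) [IsFiniteMeasure μ] {s : ℝ} (hs : 0 ≤ s) (hs1 : s < 1) :
    Integrable (fun ω => ∑ i ∈ Finset.range (Z t ω), s ^ i) μ := by
  simp only [geom_sum_eq_div hs1]
  exact ((integrable_const 1).sub (integrable_pow hZ t μ hs hs1)).div_const _

/-- The sum is (1 - s^Z)/(1 - s), an approximation of Z from below that the generating function
controls. Rewriting the quotient at time r with base F_{r,t}(s) leaves the survival ratio as a
factor. -/
theorem setIntegral_geom_sum [IsProbabilityMeasure P] (h : Admissible θ lam a)
    (hZ : IsMarkovBranchingProcess P ℱ lam (fun t => offspring θ (a t)) Z)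
    {r t : ℝ≥0} (hrt : r ≤ t) {B : Set Ω} (hB : MeasurableSet[ℱ r] B) {s : ℝ} (hs : 0 ≤ s)
    (hs1 : s < 1) :
    ∫ ω in B, ∑ i ∈ Finset.range (Z t ω), s ^ i ∂P
      = (∫ ω in B, ∑ i ∈ Finset.range (Z r ω), pgf θ lam a s t r ^ i ∂P)
        * ((1 - pgf θ lam a s t r) / (1 - s)) := by
  have hrt' : (r : ℝ) ≤ t := hrt
  have hF1 := h.pgf_lt_one hs hs1 r.coe_nonneg hrt'
  have hF0 := h.pgf_nonneg hs hs1 r.coe_nonneg hrt'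
  have h1 : 1 - s ≠ 0 := by linarith
  have h2 : 1 - pgf θ lam a s t r ≠ 0 := by linarith
  simp only [geom_sum_eq_div hs1, geom_sum_eq_div hF1, integral_div]
  rw [integral_sub (integrable_const _) (integrable_pow hZ t _ hs hs1),
    integral_sub (integrable_const _) (integrable_pow hZ r _ hF0 hF1),
    setIntegral_pow h hZ hrt hB hs hs1]
  field_simp

theorem tendsto_geom_sum {s : ℕ → ℝ} (hs : Tendsto s atTop (𝓝 1)) (n : ℕ) :
    Tendsto (fun k => ∑ i ∈ Finset.range n, s k ^ i) atTop (𝓝 n) := by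
  simpa using tendsto_finsetSum (Finset.range n) fun i _ => hs.pow i

/-- Fatou's lemma comes first, because the dominated convergence used for the exact mean takes Z
itself as the bound. -/
theorem integrable_state [IsProbabilityMeasure P] (h : Admissible θ lam a)
    (hZ : IsMarkovBranchingProcess P ℱ lam (fun t => offspring θ (a t)) Z) (t : ℝ≥0) :
    Integrable (fun ω => (Z t ω : ℝ)) P := by
  have hmeas : Measurable fun ω => (Z t ω : ℝ) :=
    (measurable_of_countable Nat.cast).comp (measurable_state hZ t)
  have hlim : Tendsto (fun k => ∫ ω, ∑ i ∈ Finset.range (Z t ω), toOne k ^ i ∂P) atTop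
      (𝓝 (Real.exp (logMean lam a t))) := by
    have h1 := h.tendsto_survival_ratio (le_refl (0 : ℝ)) t.coe_nonneg
    rw [logMean_zero, sub_zero] at h1
    refine h1.congr fun k => ?_
    have := setIntegral_geom_sum h hZ (zero_le : (0 : ℝ≥0) ≤ t) (B := univ) MeasurableSet.univ
      (toOne_nonneg k) (toOne_lt_one k)
    simpa [hZ.start] using this.symm
  refine ⟨hmeas.aestronglyMeasurable, ?_⟩
  have hfatou := lintegral_liminf_le (μ := P) (u := atTop)
    (f := fun (k : ℕ) ω => ENNReal.ofReal (∑ i ∈ Finset.range (Z t ω), toOne k ^ i))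
    fun k => (measurable_of_countable fun n =>
      ENNReal.ofReal (∑ i ∈ Finset.range n, toOne k ^ i)).comp (measurable_state hZ t)
  have hl : ∀ ω, liminf (fun k : ℕ => ENNReal.ofReal (∑ i ∈ Finset.range (Z t ω), toOne k ^ i)) atTop
      = ENNReal.ofReal (Z t ω) := fun ω =>
    ((ENNReal.continuous_ofReal.tendsto _).comp (tendsto_geom_sum tendsto_toOne (Z t ω))).liminf_eq
  have hr : liminf (fun k : ℕ => ∫⁻ ω, ENNReal.ofReal (∑ i ∈ Finset.range (Z t ω), toOne k ^ i) ∂P)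
      atTop = ENNReal.ofReal (Real.exp (logMean lam a t)) := by
    refine (((ENNReal.continuous_ofReal.tendsto _).comp hlim).congr fun k => ?_).liminf_eq
    exact ofReal_integral_eq_lintegral_ofReal
      (integrable_geom_sum hZ t P (toOne_nonneg k) (toOne_lt_one k))
      (.of_forall fun ω => Finset.sum_nonneg fun i _ => pow_nonneg (toOne_nonneg k) i)
  simp only [hl] at hfatou
  rw [hr] at hfatou
  rw [hasFiniteIntegral_iff_ofReal (.of_forall fun ω => Nat.cast_nonneg _)]
  exact hfatou.trans_lt ENNReal.ofReal_lt_top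

theorem tendsto_integral_geom_sum [IsProbabilityMeasure P] (h : Admissible θ lam a)
    (hZ : IsMarkovBranchingProcess P ℱ lam (fun t => offspring θ (a t)) Z) (t : ℝ≥0)
    (B : Set Ω) {s : ℕ → ℝ} (hs0 : ∀ k, 0 ≤ s k) (hs1 : ∀ k, s k < 1)
    (hs : Tendsto s atTop (𝓝 1)) :
    Tendsto (fun k => ∫ ω in B, ∑ i ∈ Finset.range (Z t ω), s k ^ i ∂P) atTop
      (𝓝 (∫ ω in B, (Z t ω : ℝ) ∂P)) := by
  refine tendsto_integral_of_dominated_convergence (fun ω => (Z t ω : ℝ))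
    (fun k => (integrable_geom_sum hZ t _ (hs0 k) (hs1 k)).aestronglyMeasurable)
    (integrable_state h hZ t).integrableOn (fun k => .of_forall fun ω => ?_)
    (.of_forall fun ω => tendsto_geom_sum hs _)
  rw [Real.norm_of_nonneg (Finset.sum_nonneg fun i _ => pow_nonneg (hs0 k) i)]
  exact geom_sum_le_card (hs0 k) (hs1 k) _

/-- The conditional mean of the process. -/
theorem setIntegral_state [IsProbabilityMeasure P] (h : Admissible θ lam a)
    (hZ : IsMarkovBranchingProcess P ℱ lam (fun t => offspring θ (a t)) Z)
    {r t : ℝ≥0} (hrt : r ≤ t) {B : Set Ω} (hB : MeasurableSet[ℱ r] B) :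
    ∫ ω in B, (Z t ω : ℝ) ∂P
      = (∫ ω in B, (Z r ω : ℝ) ∂P) * Real.exp (logMean lam a t - logMean lam a r) := by
  have hrt' : (r : ℝ) ≤ t := hrt
  refine tendsto_nhds_unique
    (tendsto_integral_geom_sum h hZ t B toOne_nonneg toOne_lt_one tendsto_toOne) ?_
  refine ((tendsto_integral_geom_sum h hZ r B
    (fun k => h.pgf_nonneg (toOne_nonneg k) (toOne_lt_one k) r.coe_nonneg hrt')
    (fun k => h.pgf_lt_one (toOne_nonneg k) (toOne_lt_one k) r.coe_nonneg hrt')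
    (h.tendsto_pgf_toOne r.coe_nonneg hrt')).mul
    (h.tendsto_survival_ratio r.coe_nonneg hrt')).congr fun k => ?_
  exact (setIntegral_geom_sum h hZ hrt hB (toOne_nonneg k) (toOne_lt_one k)).symm

theorem mean_eq [IsProbabilityMeasure P] (h : Admissible θ lam a)
    (hZ : IsMarkovBranchingProcess P ℱ lam (fun t => offspring θ (a t)) Z) (t : ℝ≥0) :
    mean P Z t = Real.exp (logMean lam a t) := by
  have := setIntegral_state h hZ (zero_le : (0 : ℝ≥0) ≤ t) (B := univ) MeasurableSet.univ
  simpa [hZ.start, logMean_zero, mean] using this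

end ThetaPositive

/-! ### Almost sure convergence of right-continuous martingales in continuous time -/

section MartingaleConvergence

variable {Ω : Type*} {mΩ : MeasurableSpace Ω} {P : Measure Ω}
  {ℱ : Filtration ℝ≥0 mΩ} {M : ℝ≥0 → Ω → ℝ}

/-- A filtration observed along a monotone sequence of times. -/
def sampledFiltration (ℱ : Filtration ℝ≥0 mΩ) {τ : ℕ → ℝ≥0} (hτ : Monotone τ) :
    Filtration ℕ mΩ where
  seq k := ℱ (τ k)
  mono' _ _ hij := ℱ.mono (hτ hij)
  le' k := ℱ.le (τ k)

theorem martingale_sampled (hM : Martingale M ℱ P) {τ : ℕ → ℝ≥0} (hτ : Monotone τ) :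
    Martingale (fun k => M (τ k)) (sampledFiltration ℱ hτ) P :=
  ⟨fun k => hM.stronglyAdapted (τ k), fun _ _ hij => hM.condExp_ae_eq (hτ hij)⟩

theorem submartingale_abs_sub [IsProbabilityMeasure P] (hM : Martingale M ℱ P)
    {τ : ℕ → ℝ≥0} (hτ : Monotone τ) :
    Submartingale (fun k ω => |M (τ k) ω - M (τ 0) ω|) (sampledFiltration ℱ hτ) P := by
  have h0 : Martingale (fun (_ : ℕ) => M (τ 0)) (sampledFiltration ℱ hτ) P := by
    refine ⟨fun k => (hM.stronglyAdapted (τ 0)).mono (ℱ.mono (hτ (Nat.zero_le k))),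
      fun i _ _ => ?_⟩
    rw [condExp_of_stronglyMeasurable ((sampledFiltration ℱ hτ).le i)
      ((hM.stronglyAdapted (τ 0)).mono (ℱ.mono (hτ (Nat.zero_le i)))) (hM.integrable _)]
  have h1 := (martingale_sampled hM hτ).sub h0
  have h2 := h1.submartingale.sup h1.neg.submartingale
  convert! h2 using 2

/-- Doob's maximal inequality for the oscillation of a right-continuous martingale after `s`. -/
theorem measure_exists_lt_abs_sub_le [IsProbabilityMeasure P] (hM : Martingale M ℱ P)
    (hcont : ∀ ω t, ContinuousWithinAt (fun u => M u ω) (Ici t) t) (s : ℝ≥0) {δ ε : ℝ}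
    (hε : 0 < ε) (hδ : ∀ t, s ≤ t → ∫ ω, |M t ω - M s ω| ∂P ≤ δ) :
    P {ω | ∃ t, s ≤ t ∧ ε < |M t ω - M s ω|} ≤ ENNReal.ofReal (δ / ε) := by
  -- Dyadic grids are nested, so the exceedance events increase with m and the discrete maximal
  -- inequality passes to their union.
  let τ : ℕ → ℕ → ℝ≥0 := fun m k => s + k / 2 ^ m
  have hτ : ∀ m, Monotone (τ m) := fun m i j hij => by
    simp only [τ]
    gcongr
  have hτ0 : ∀ m, τ m 0 = s := fun m => by simp [τ]
  let E : ℕ → ℕ → Set Ω := fun m K => {ω | ∃ k ≤ K, ε < |M (τ m k) ω - M s ω|}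
  have hE : ∀ m K, P (E m K) ≤ ENNReal.ofReal (δ / ε) := by
    intro m K
    have h1 := maximal_ineq (submartingale_abs_sub hM (hτ m)) (fun k ω => abs_nonneg _)
      (ε := ε.toNNReal) K
    have hsub := submartingale_abs_sub hM (hτ m)
    simp only [hτ0] at h1 hsub
    have h2 : E m K ⊆ {ω | (ε.toNNReal : ℝ) ≤ (Finset.range (K + 1)).sup'
        Finset.nonempty_range_add_one fun k => |M (τ m k) ω - M s ω|} := by
      rintro ω ⟨k, hk, hlt⟩
      rw [mem_ofPred_eq, Real.coe_toNNReal ε hε.le, Finset.le_sup'_iff]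
      exact ⟨k, Finset.mem_range.2 (by omega), hlt.le⟩
    have h3 : ∫ ω in {ω | (ε.toNNReal : ℝ) ≤ (Finset.range (K + 1)).sup'
        Finset.nonempty_range_add_one fun k => |M (τ m k) ω - M s ω|}, |M (τ m K) ω - M s ω| ∂P
        ≤ δ :=
      (setIntegral_le_integral (hsub.integrable K) (.of_forall fun ω => abs_nonneg _)).trans
        (hδ _ (le_add_of_nonneg_right zero_le))
    have h4 := (mul_le_mul_right (measure_mono (μ := P) h2) (ε.toNNReal : ℝ≥0∞)).trans
      (h1.trans (ENNReal.ofReal_le_ofReal h3))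
    rw [ENNReal.ofReal_div_of_pos hε, ENNReal.le_div_iff_mul_le (by simp [hε]) (by simp), mul_comm]
    exact h4
  have hEmono : ∀ m, Monotone (E m) := fun m i j hij ω ⟨k, hk, hlt⟩ => ⟨k, hk.trans hij, hlt⟩
  have hEU : ∀ m, P (⋃ K, E m K) ≤ ENNReal.ofReal (δ / ε) := fun m => by
    rw [(hEmono m).measure_iUnion]
    exact iSup_le (hE m)
  have hUmono : Monotone fun m => ⋃ K, E m K := by
    refine monotone_nat_of_le_succ fun m => ?_
    refine iUnion_subset fun K ω ⟨k, _, hlt⟩ => mem_iUnion.2 ⟨2 * k, 2 * k, le_rfl, ?_⟩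
    have : τ (m + 1) (2 * k) = τ m k := by
      simp only [τ]
      congr 1
      rw [pow_succ]
      push_cast
      field_simp
    rwa [this]
  refine (measure_mono (t := ⋃ m, ⋃ K, E m K) ?_).trans ?_
  · rintro ω ⟨t, hst, hlt⟩
    have h1 : ∀ᶠ u in 𝓝[≥] t, ε < |M u ω - M s ω| :=
      ((hcont ω t).sub continuousWithinAt_const).abs.eventually (lt_mem_nhds hlt)
    -- The strict inequality persists just to the right of t, where a dyadic time is found.
    -- `gridRight n` has mesh 1/(n + 1), hence the index 2^m - 1.
    have h2 : Tendsto (fun m : ℕ => s + gridRight (2 ^ m - 1) (t - s)) atTop (𝓝[≥] t) := by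
      have h3 : Tendsto (fun m : ℕ => 2 ^ m - 1) atTop atTop := by
        refine tendsto_atTop_mono (fun m => ?_) tendsto_id
        have := Nat.lt_two_pow_self (n := m)
        simp only [id]
        omega
      have h4 := (tendsto_nhdsWithin_iff.1 (tendsto_gridRight (t - s))).1.comp h3
      refine tendsto_nhdsWithin_iff.2 ⟨?_, .of_forall fun m => ?_⟩
      · simpa [add_tsub_cancel_of_le hst] using h4.const_add s
      · rw [mem_Ici, ← tsub_le_iff_left]
        exact (lt_gridRight _ _).le
    obtain ⟨m, hm⟩ := (h2.eventually h1).exists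
    have h5 : s + gridRight (2 ^ m - 1) (t - s)
        = τ m (⌊(((2 ^ m - 1 : ℕ) : ℝ≥0) + 1) * (t - s)⌋₊ + 1) := by
      simp only [τ, gridRight]
      congr 2
      exact_mod_cast Nat.sub_add_cancel (Nat.one_le_two_pow (n := m))
    rw [h5] at hm
    exact mem_iUnion.2 ⟨m, mem_iUnion.2 ⟨_, _, le_rfl, hm⟩⟩
  · rw [hUmono.measure_iUnion]
    exact iSup_le hEU

/-- A nonnegative right-continuous martingale which converges along the integers without loss of
mass converges almost surely. -/
theorem ae_tendsto_of_integral_le [IsProbabilityMeasure P] (hM : Martingale M ℱ P)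
    (hcont : ∀ ω t, ContinuousWithinAt (fun u => M u ω) (Ici t) t) (hM0 : ∀ t ω, 0 ≤ M t ω)
    {W : Ω → ℝ} (hW : Integrable W P)
    (hlim : ∀ᵐ ω ∂P, Tendsto (fun k : ℕ => M k ω) atTop (𝓝 (W ω)))
    (hmass : ∫ ω, M 0 ω ∂P ≤ ∫ ω, W ω ∂P) :
    ∀ᵐ ω ∂P, Tendsto (fun t => M t ω) atTop (𝓝 (W ω)) := by
  have hconst : ∀ t, ∫ ω, M t ω ∂P = ∫ ω, M 0 ω ∂P := fun t => by
    simpa using (hM.setIntegral_eq (zero_le : (0 : ℝ≥0) ≤ t) MeasurableSet.univ).symm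
  have hMW : ∀ k : ℕ, Integrable (fun ω => M k ω - W ω) P := fun k => (hM.integrable k).sub hW
  have hWM : ∀ k : ℕ, Integrable (fun ω => max (W ω - M k ω) 0) P := fun k =>
    (hW.sub (hM.integrable k)).pos_part
  have habs : ∀ k : ℕ, Integrable (fun ω => |M k ω - W ω|) P := fun k => (hMW k).abs
  -- Scheffé's argument: |x| = x + 2 max(-x, 0) with x = M - W. The mean of x is at most 0 by
  -- `hmass`, and the other part is dominated by |W| since M ≥ 0.
  have hL1 : Tendsto (fun k : ℕ => ∫ ω, |M k ω - W ω| ∂P) atTop (𝓝 0) := by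
    have hpos : Tendsto (fun k : ℕ => ∫ ω, max (W ω - M k ω) 0 ∂P) atTop
        (𝓝 (∫ _, (0 : ℝ) ∂P)) := by
      refine tendsto_integral_of_dominated_convergence (fun ω => |W ω|)
        (fun k => (hWM k).aestronglyMeasurable) hW.abs
        (fun k => .of_forall fun ω => ?_) ?_
      · rw [Real.norm_of_nonneg (le_max_right _ _)]
        exact max_le ((sub_le_self _ (hM0 k ω)).trans (le_abs_self _)) (abs_nonneg _)
      · filter_upwards [hlim] with ω hω
        simpa using (hω.const_sub (W ω)).max (tendsto_const_nhds (x := (0 : ℝ)))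
    rw [integral_zero] at hpos
    refine squeeze_zero (fun k => integral_nonneg fun ω => abs_nonneg _) (fun k => ?_)
      (by simpa using hpos.const_mul 2)
    have h1 : ∀ ω, |M k ω - W ω| = (M k ω - W ω) + 2 * max (W ω - M k ω) 0 := fun ω => by
      rcases le_total (W ω) (M k ω) with hle | hle
      · rw [max_eq_right (by linarith), abs_of_nonneg (by linarith)]
        ring
      · rw [max_eq_left (by linarith), abs_of_nonpos (by linarith)]
        ring
    simp only [h1]
    rw [integral_add (hMW k) ((hWM k).const_mul 2),
      integral_const_mul, integral_sub (hM.integrable k) hW, hconst]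
    linarith
  have hosc : ∀ (n : ℕ) (t : ℝ≥0), (n : ℝ≥0) ≤ t → ∫ ω, |M t ω - M n ω| ∂P
      ≤ ∫ ω, |M n ω - W ω| ∂P := by
    intro n t hnt
    refine ge_of_tendsto (x := atTop)
      (f := fun k : ℕ => (∫ ω, |M k ω - W ω| ∂P) + ∫ ω, |M n ω - W ω| ∂P)
      (by simpa using hL1.add_const _) ?_
    obtain ⟨k₀, hk₀⟩ := exists_nat_ge t
    filter_upwards [eventually_ge_atTop k₀] with k hk
    have htk : t ≤ k := hk₀.trans (by exact_mod_cast hk)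
    -- Sampling at n, t, k makes E|M_t - M_n| ≤ E|M_k - M_n| an instance of the discrete
    -- submartingale property.
    let τ : ℕ → ℝ≥0 := fun i => if i = 0 then n else if i = 1 then t else k
    have hτ : Monotone τ := monotone_nat_of_le_succ fun i => by
      match i with
      | 0 => simpa [τ] using hnt
      | 1 => simpa [τ] using htk
      | i + 2 => simp [τ]
    have h1 := (submartingale_abs_sub hM hτ).setIntegral_le (show 1 ≤ 2 by norm_num)
      MeasurableSet.univ
    simp only [Measure.restrict_univ, τ] at h1
    norm_num at h1
    refine h1.trans ?_
    rw [← integral_add (habs k) (habs n)]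
    refine integral_mono ((hM.integrable k).sub (hM.integrable n)).abs
      ((habs k).add (habs n)) fun ω => ?_
    have := abs_sub_le (M k ω) (W ω) (M n ω)
    rwa [abs_sub_comm (W ω)] at this
  have hsmall : ∀ j : ℕ, ∀ᵐ ω ∂P, ∃ n : ℕ, ∀ t, (n : ℝ≥0) ≤ t →
      |M t ω - M n ω| ≤ 1 / (j + 1) := by
    intro j
    have hj : (0 : ℝ) < 1 / (j + 1) := by positivity
    rw [ae_iff]
    refine le_antisymm (ge_of_tendsto' (x := atTop) (f := fun n : ℕ =>
      ENNReal.ofReal ((∫ ω, |M n ω - W ω| ∂P) / (1 / (j + 1)))) ?_ fun n => ?_) zero_le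
    · have := (ENNReal.continuous_ofReal.tendsto _).comp (hL1.div_const (1 / ((j : ℝ) + 1)))
      rwa [zero_div, ENNReal.ofReal_zero] at this
    · refine (measure_mono fun ω hω => ?_).trans
        (measure_exists_lt_abs_sub_le hM hcont n hj (hosc n))
      rw [mem_ofPred_eq] at hω ⊢
      push Not at hω
      exact hω n
  filter_upwards [hlim, ae_all_iff.2 hsmall] with ω hω hj
  rw [Metric.tendsto_atTop]
  intro ε hε
  obtain ⟨j, hjε⟩ := exists_nat_one_div_lt (show 0 < ε / 2 by linarith)
  obtain ⟨n, hn⟩ := hj j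
  have hWn : |W ω - M n ω| ≤ 1 / (j + 1) := by
    refine le_of_tendsto (hω.sub_const (M n ω)).abs ?_
    filter_upwards [eventually_ge_atTop n] with k hk
    exact hn k (by exact_mod_cast hk)
  refine ⟨n, fun t ht => ?_⟩
  rw [Real.dist_eq]
  have := abs_sub_le (M t ω) (M n ω) (W ω)
  rw [abs_sub_comm (M n ω)] at this
  linarith [hn t ht]

end MartingaleConvergence

/-! ### The normalized process and the supercritical regime -/

section Supercritical

variable {θ : ℝ} {lam a : ℝ → ℝ}

theorem Admissible.continuous_logMean (h : Admissible θ lam a) :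
    Continuous fun t : ℝ≥0 => logMean lam a t := by
  refine continuous_iff_continuousAt.2 fun t => ?_
  have h1 : (0 : ℝ) ≤ t + 1 := add_nonneg t.coe_nonneg zero_le_one
  have hc := (h.hasACDeriv_logMean h1).continuousOn
  rw [uIcc_of_le h1] at hc
  refine Tendsto.comp (hc t ⟨t.coe_nonneg, by linarith⟩)
    (tendsto_nhdsWithin_iff.2 ⟨NNReal.continuous_coe.tendsto t, ?_⟩)
  filter_upwards [Iio_mem_nhds (show t < t + 1 from lt_add_one t)] with u hu
  exact ⟨u.coe_nonneg, by exact_mod_cast (le_of_lt hu : u ≤ t + 1)⟩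

/-- Both sides equal (1 - P(Z_t = 0))^{-θ}; the right side shows its dependence on V. -/
theorem Admissible.exp_add_R_eq (h : Admissible θ lam a) (t : ℝ) :
    Real.exp (-θ * logMean lam a t) + R θ lam a t
      = V' θ lam a t + (1 + θ)⁻¹ + θ * (1 + θ)⁻¹ * Real.exp (-θ * logMean lam a t) := by
  have : 1 + θ ≠ 0 := by linarith [h.theta_pos]
  rw [R]
  field_simp
  ring

theorem Admissible.tendsto_exp_logMean (h : Admissible θ lam a)
    (hm : Tendsto (fun t : ℝ≥0 => logMean lam a t) atTop atTop) :
    Tendsto (fun t : ℝ≥0 => Real.exp (-θ * logMean lam a t)) atTop (𝓝 0) :=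
  Real.tendsto_exp_atBot.comp (hm.const_mul_atTop_of_neg (neg_lt_zero.2 h.theta_pos))

theorem Admissible.V'_nonneg (h : Admissible θ lam a) (t : ℝ≥0) : 0 ≤ V' θ lam a t := by
  refine intervalIntegral.integral_nonneg t.coe_nonneg fun u hu => ?_
  have := h.theta_pos
  have := h.rate_nonneg u hu.1
  positivity

theorem Admissible.tendsto_R (h : Admissible θ lam a) {v : ℝ}
    (hm : Tendsto (fun t : ℝ≥0 => logMean lam a t) atTop atTop)
    (hv : Tendsto (fun t : ℝ≥0 => V' θ lam a t) atTop (𝓝 v)) :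
    Tendsto (fun t : ℝ≥0 => R θ lam a t) atTop (𝓝 (v + (1 + θ)⁻¹)) := by
  simpa [R] using hv.add (((h.tendsto_exp_logMean hm).const_sub 1).const_mul (1 + θ)⁻¹)

/-- `μ_t ≤ exp (Λ_t / θ)`. -/
theorem Admissible.logMean_le (h : Admissible θ lam a) (t : ℝ≥0) :
    logMean lam a t ≤ 1 / θ * cumHazard lam t := by
  rw [logMean, cumHazard, ← intervalIntegral.integral_const_mul]
  refine intervalIntegral.integral_mono_on t.coe_nonneg
    (h.hasACDeriv_logMean t.coe_nonneg).intervalIntegrable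
    ((h.rate_integrable t t.coe_nonneg).const_mul _) fun u hu => ?_
  exact mul_le_mul_of_nonneg_right (by linarith [h.le u hu.1]) (h.rate_nonneg u hu.1)

/-- If `V_θ < ∞` and `Λ = ∞` then `μ_t → ∞`. -/
theorem Admissible.tendsto_logMean (h : Admissible θ lam a) {v : ℝ}
    (hv : Tendsto (fun t : ℝ≥0 => V' θ lam a t) atTop (𝓝 v))
    (hΛ : Tendsto (cumHazard lam) atTop atTop) :
    Tendsto (fun t : ℝ≥0 => logMean lam a t) atTop atTop := by
  have h0 := h.theta_pos
  have hRmono : Monotone fun t : ℝ≥0 => R θ lam a t := fun s t hst =>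
    h.R_mono s.coe_nonneg hst
  have hexp : ∀ t : ℝ≥0, Real.exp (-θ * logMean lam a t)
      = 1 + (1 + θ) * (V' θ lam a t - R θ lam a t) := fun t => by
    have : 1 + θ ≠ 0 := by linarith
    rw [R]
    field_simp
    ring
  -- R is nondecreasing and stays below V + 1/(1+θ), so it converges; hence μ^{-θ} = 1 + (1+θ)(V -
  -- R) converges too.
  obtain ⟨c, hc⟩ : ∃ c, Tendsto (fun t : ℝ≥0 => R θ lam a t) atTop (𝓝 c) := by
    refine (tendsto_atTop_of_monotone hRmono).resolve_left fun htop => ?_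
    refine not_tendsto_atTop_of_tendsto_nhds (hv.add_const (1 + θ)⁻¹)
      (tendsto_atTop_mono (fun t => ?_) htop)
    have h1 : 0 < (1 + θ)⁻¹ := by positivity
    have h2 := mul_pos h1 (Real.exp_pos (-θ * logMean lam a t))
    rw [R]
    linarith
  have hlim : Tendsto (fun t : ℝ≥0 => Real.exp (-θ * logMean lam a t)) atTop
      (𝓝 (1 + (1 + θ) * (v - c))) := by
    simp only [hexp]
    exact ((hv.sub hc).const_mul _).const_add _
  set l := 1 + (1 + θ) * (v - c)
  have hl : l = 0 := by
    refine le_antisymm ?_ (ge_of_tendsto' hlim fun t => (Real.exp_nonneg _))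
    -- If μ^{-θ} had a positive limit l, it would exceed l/2 from some T on. The increments of V
    -- would then dominate a multiple of those of Λ, contradicting the convergence of V.
    by_contra! hpos
    obtain ⟨T, hT⟩ := eventually_atTop.1 (hlim.eventually (lt_mem_nhds (half_lt_self hpos)))
    have hk : 0 < θ / (1 + θ) * (l / 2) := by positivity
    refine not_tendsto_atTop_of_tendsto_nhds (hv.sub_const (V' θ lam a T))
      (tendsto_atTop_mono' _ ?_ ((tendsto_atTop_add_const_right _ (-cumHazard lam T)
        hΛ).const_mul_atTop hk))
    filter_upwards [eventually_ge_atTop T] with t hTt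
    have hTt' : (T : ℝ) ≤ t := hTt
    have hsub : uIcc (T : ℝ) t ⊆ uIcc 0 (t : ℝ) := by
      rw [uIcc_of_le hTt', uIcc_of_le t.coe_nonneg]
      exact Icc_subset_Icc_left T.coe_nonneg
    have hV := (h.hasACDeriv_V' t.coe_nonneg).mono hsub
    have hL := ((h.rate_integrable t t.coe_nonneg).hasACDeriv left_mem_uIcc).mono hsub
    have h1 : cumHazard lam t + -cumHazard lam T = ∫ u in (T : ℝ)..t, lam u :=
      (sub_eq_add_neg _ _).symm.trans hL.integral_eq_sub.symm
    rw [h1, ← hV.integral_eq_sub, ← intervalIntegral.integral_const_mul]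
    refine intervalIntegral.integral_mono_on hTt' (hL.intervalIntegrable.const_mul _)
      hV.intervalIntegrable fun u hu => ?_
    have hu0 : 0 ≤ u := T.coe_nonneg.trans hu.1
    have h2 := hT u.toNNReal (NNReal.le_toNNReal_of_coe_le hu.1)
    rw [Real.coe_toNNReal u hu0] at h2
    have h3 := h.rate_nonneg u hu0
    rw [mul_assoc]
    gcongr
  rw [hl] at hlim
  have h1 : Tendsto (fun t : ℝ≥0 => Real.log (Real.exp (-θ * logMean lam a t))) atTop atBot :=
    Real.tendsto_log_nhdsGT_zero.comp (tendsto_nhdsWithin_iff.2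
      ⟨hlim, .of_forall fun t => Real.exp_pos _⟩)
  simp only [Real.log_exp] at h1
  have h2 := h1.const_mul_atBot_of_neg (neg_lt_zero.2 (inv_pos.2 h0))
  refine h2.congr fun t => ?_
  field_simp

theorem tendsto_one_sub_exp_div (w : ℝ) :
    Tendsto (fun x : ℝ => (1 - Real.exp (-w * x)) / x) (𝓝[>] 0) (𝓝 w) := by
  have h1 : HasDerivAt (fun x : ℝ => 1 - Real.exp (-w * x)) w 0 := by
    have := (((hasDerivAt_id (0 : ℝ)).const_mul (-w)).exp).const_sub 1
    simpa using this
  have h2 := h1.tendsto_slope_zero_right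
  refine h2.congr fun x => ?_
  simp [div_eq_inv_mul]

/-- The generating function at `exp (-w / μ_t)` converges to the limiting Laplace transform. -/
theorem Admissible.tendsto_laplace (h : Admissible θ lam a) {v w : ℝ} (hw : 0 < w)
    (hm : Tendsto (fun t : ℝ≥0 => logMean lam a t) atTop atTop)
    (hv : Tendsto (fun t : ℝ≥0 => V' θ lam a t) atTop (𝓝 v)) :
    Tendsto (fun t : ℝ≥0 => 1 - (Real.exp (-θ * logMean lam a t)
      * (1 - Real.exp (-w * Real.exp (-logMean lam a t))) ^ (-θ) + R θ lam a t) ^ (-1 / θ)) atTop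
      (𝓝 (1 - (v + (1 + θ)⁻¹ + w ^ (-θ)) ^ (-1 / θ))) := by
  have h0 := h.theta_pos
  have hx : Tendsto (fun t : ℝ≥0 => Real.exp (-logMean lam a t)) atTop (𝓝[>] 0) :=
    tendsto_nhdsWithin_iff.2 ⟨Real.tendsto_exp_atBot.comp (tendsto_neg_atTop_atBot.comp hm),
      .of_forall fun t => Real.exp_pos _⟩
  have h1 := ((tendsto_one_sub_exp_div w).comp hx).rpow_const (p := -θ) (Or.inl hw.ne')
  have h2 : ∀ t : ℝ≥0, ((1 - Real.exp (-w * Real.exp (-logMean lam a t)))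
      / Real.exp (-logMean lam a t)) ^ (-θ) = Real.exp (-θ * logMean lam a t)
      * (1 - Real.exp (-w * Real.exp (-logMean lam a t))) ^ (-θ) := fun t => by
    have h3 : Real.exp (-w * Real.exp (-logMean lam a t)) ≤ 1 := by
      rw [Real.exp_le_one_iff]
      have := Real.exp_pos (-logMean lam a t)
      nlinarith
    rw [Real.div_rpow (by linarith) (Real.exp_nonneg _), ← Real.exp_mul, div_eq_mul_inv,
      ← Real.exp_neg, mul_comm]
    congr 2
    ring
  have h4 : Tendsto (fun t : ℝ≥0 => Real.exp (-θ * logMean lam a t)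
      * (1 - Real.exp (-w * Real.exp (-logMean lam a t))) ^ (-θ)) atTop (𝓝 (w ^ (-θ))) :=
    h1.congr h2
  have hv0 : 0 ≤ v := ge_of_tendsto' hv h.V'_nonneg
  have h5 := (h4.add (h.tendsto_R hm hv)).rpow_const (p := -1 / θ) (Or.inl (by positivity))
  rw [add_comm (w ^ (-θ))] at h5
  exact h5.const_sub 1

variable {Ω : Type*} {mΩ : MeasurableSpace Ω} {P : Measure Ω} [IsProbabilityMeasure P]
  {ℱ : Filtration ℝ≥0 mΩ} {Z : ℝ≥0 → Ω → ℕ}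

/-- The probability of extinction by time `t`. -/
theorem extinction_prob (h : Admissible θ lam a)
    (hZ : IsMarkovBranchingProcess P ℱ lam (fun t => offspring θ (a t)) Z) (t : ℝ≥0) :
    P.real {ω | Z t ω = 0}
      = 1 - (Real.exp (-θ * logMean lam a t) + R θ lam a t) ^ (-1 / θ) := by
  -- At s = 0 the convention 0^0 = 1 turns s^Z into the indicator of extinction.
  have h1 := integral_pow_eq h hZ t le_rfl zero_lt_one
  rw [sub_zero, Real.one_rpow, mul_one] at h1
  rw [← h1]
  have h2 : MeasurableSet {ω | Z t ω = 0} := measurable_state hZ t (measurableSet_singleton 0)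
  rw [← integral_indicator_one h2]
  refine integral_congr_ae (.of_forall fun ω => ?_)
  by_cases hω : Z t ω = 0
  · simp [hω]
  · simp [hω]

theorem tendsto_extinction_prob (h : Admissible θ lam a)
    (hZ : IsMarkovBranchingProcess P ℱ lam (fun t => offspring θ (a t)) Z) {v : ℝ}
    (hm : Tendsto (fun t : ℝ≥0 => logMean lam a t) atTop atTop)
    (hv : Tendsto (fun t : ℝ≥0 => V' θ lam a t) atTop (𝓝 v)) :
    Tendsto (fun t => P.real {ω | Z t ω = 0}) atTop (𝓝 (1 - (v + (1 + θ)⁻¹) ^ (-1 / θ))) := by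
  have h0 := h.theta_pos
  have hv0 : 0 ≤ v := ge_of_tendsto' hv h.V'_nonneg
  simp only [extinction_prob h hZ]
  have h1 := ((h.tendsto_exp_logMean hm).add (h.tendsto_R hm hv)).rpow_const (p := -1 / θ)
    (Or.inl (by positivity))
  rw [zero_add] at h1
  exact h1.const_sub 1

/-- If extinction is not certain and `μ_t → ∞` then `V_θ < ∞`. -/
theorem exists_tendsto_V' (h : Admissible θ lam a)
    (hZ : IsMarkovBranchingProcess P ℱ lam (fun t => offspring θ (a t)) Z) {q : ℝ} (hq : q < 1)
    (hlim : Tendsto (fun t => P.real {ω | Z t ω = 0}) atTop (𝓝 q))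
    (hm : Tendsto (fun t : ℝ≥0 => logMean lam a t) atTop atTop) :
    ∃ v, Tendsto (fun t : ℝ≥0 => V' θ lam a t) atTop (𝓝 v) := by
  have h0 := h.theta_pos
  -- Since 1 - q > 0, the power -θ is continuous there; it inverts the extinction formula and
  -- isolates V.
  have h1 := (hlim.const_sub 1).rpow_const (p := -θ) (Or.inl (by linarith))
  have h2 : ∀ t : ℝ≥0, (1 - P.real {ω | Z t ω = 0}) ^ (-θ)
      = V' θ lam a t + (1 + θ)⁻¹ + θ * (1 + θ)⁻¹ * Real.exp (-θ * logMean lam a t) := fun t => by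
    have hpos : 0 ≤ Real.exp (-θ * logMean lam a t) + R θ lam a t :=
      add_nonneg (Real.exp_nonneg _) (h.R_nonneg t.coe_nonneg)
    rw [extinction_prob h hZ, sub_sub_cancel, ← Real.rpow_mul hpos,
      show -1 / θ * -θ = 1 by field_simp, Real.rpow_one, h.exp_add_R_eq]
  simp only [h2] at h1
  have h3 := (h1.sub ((h.tendsto_exp_logMean hm).const_mul (θ * (1 + θ)⁻¹))).sub_const (1 + θ)⁻¹
  exact ⟨_, h3.congr fun t => by ring⟩

/-- The normalized process `Z_t / μ_t` is a martingale. -/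
theorem martingale_normalized (h : Admissible θ lam a)
    (hZ : IsMarkovBranchingProcess P ℱ lam (fun t => offspring θ (a t)) Z) :
    Martingale (fun (t : ℝ≥0) ω => Real.exp (-logMean lam a t) * (Z t ω : ℝ)) ℱ P := by
  have hadp : ∀ t : ℝ≥0, StronglyMeasurable[ℱ t]
      fun ω => Real.exp (-logMean lam a t) * (Z t ω : ℝ) := fun t =>
    ((measurable_of_countable fun n : ℕ => Real.exp (-logMean lam a t) * (n : ℝ)).comp
      (hZ.adapted t)).stronglyMeasurable
  have hint : ∀ t : ℝ≥0, Integrable (fun ω => Real.exp (-logMean lam a t) * (Z t ω : ℝ)) P :=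
    fun t => (integrable_state h hZ t).const_mul _
  refine ⟨hadp, fun r t hrt => ?_⟩
  refine (ae_eq_condExp_of_forall_setIntegral_eq (ℱ.le r) (hint t)
    (fun B _ _ => (hint r).integrableOn) (fun B hB _ => ?_) (hadp r).aestronglyMeasurable).symm
  rw [integral_const_mul, integral_const_mul, setIntegral_state h hZ hrt hB, Real.exp_sub,
    Real.exp_neg, Real.exp_neg]
  have := (Real.exp_pos (logMean lam a t)).ne'
  field_simp

theorem integral_exp_normalized (h : Admissible θ lam a)
    (hZ : IsMarkovBranchingProcess P ℱ lam (fun t => offspring θ (a t)) Z) (t : ℝ≥0) {w : ℝ}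
    (hw : 0 < w) :
    ∫ ω, Real.exp (-w * (Real.exp (-logMean lam a t) * (Z t ω : ℝ))) ∂P
      = 1 - (Real.exp (-θ * logMean lam a t)
        * (1 - Real.exp (-w * Real.exp (-logMean lam a t))) ^ (-θ) + R θ lam a t) ^ (-1 / θ) := by
  have hs : Real.exp (-w * Real.exp (-logMean lam a t)) < 1 := by
    rw [Real.exp_lt_one_iff]
    have := mul_pos hw (Real.exp_pos (-logMean lam a t))
    linarith
  rw [← integral_pow_eq h hZ t (Real.exp_nonneg _) hs]
  refine integral_congr_ae (.of_forall fun ω => ?_)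
  simp only [← Real.exp_nat_mul]
  congr 1
  ring

/-- Almost sure convergence of the normalized process in the supercritical case. -/
theorem exists_limit_normalized (h : Admissible θ lam a)
    (hZ : IsMarkovBranchingProcess P ℱ lam (fun t => offspring θ (a t)) Z) {v : ℝ}
    (hm : Tendsto (fun t : ℝ≥0 => logMean lam a t) atTop atTop)
    (hv : Tendsto (fun t : ℝ≥0 => V' θ lam a t) atTop (𝓝 v)) :
    ∃ W : Ω → ℝ, Measurable W ∧ (∀ᵐ ω ∂P, 0 ≤ W ω) ∧
      (∀ᵐ ω ∂P, Tendsto (fun t : ℝ≥0 => Real.exp (-logMean lam a t) * (Z t ω : ℝ)) atTop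
        (𝓝 (W ω))) ∧
      ∀ w : ℝ, 0 < w → ∫ ω, Real.exp (-w * W ω) ∂P
        = 1 - (v + (1 + θ)⁻¹ + w ^ (-θ)) ^ (-1 / θ) := by
  have h0 := h.theta_pos
  have hv0 : 0 ≤ v := ge_of_tendsto' hv h.V'_nonneg
  set M : ℝ≥0 → Ω → ℝ := fun t ω => Real.exp (-logMean lam a t) * (Z t ω : ℝ) with hMdef
  have hM : Martingale M ℱ P := martingale_normalized h hZ
  have hM0 : ∀ t ω, 0 ≤ M t ω := fun t ω =>
    mul_nonneg (Real.exp_nonneg _) (Nat.cast_nonneg _)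
  have hMzero : ∀ ω, M 0 ω = 1 := fun ω => by simp [hMdef, logMean_zero, hZ.start]
  have hM1 : ∀ t, ∫ ω, M t ω ∂P = 1 := fun t => by
    have := hM.setIntegral_eq (zero_le : (0 : ℝ≥0) ≤ t) MeasurableSet.univ
    simpa [hMzero] using this.symm
  have hτ : Monotone fun k : ℕ => (k : ℝ≥0) := Nat.mono_cast
  have hsub := (martingale_sampled hM hτ).submartingale
  have hbdd : ∀ k : ℕ, eLpNorm (M k) 1 P ≤ (1 : ℝ≥0) := fun k => by
    rw [eLpNorm_one_eq_lintegral_enorm, ← ofReal_integral_norm_eq_lintegral_enorm (hM.integrable k)]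
    simp only [Real.norm_of_nonneg (hM0 _ _), hM1]
    simp
  obtain ⟨W, hlim, hWmeas, hWint⟩ : ∃ W : Ω → ℝ,
      (∀ᵐ ω ∂P, Tendsto (fun k : ℕ => M k ω) atTop (𝓝 (W ω))) ∧ Measurable W ∧ Integrable W P :=
    ⟨_, hsub.ae_tendsto_limitProcess hbdd, Filtration.stronglyMeasurable_limit_process'.measurable,
      memLp_one_iff_integrable.1 (hsub.memLp_limitProcess hbdd)⟩
  have hW0 : ∀ᵐ ω ∂P, 0 ≤ W ω := by
    filter_upwards [hlim] with ω hω using ge_of_tendsto' hω fun k => hM0 k ω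
  have hlap : ∀ w : ℝ, 0 < w → ∫ ω, Real.exp (-w * W ω) ∂P
      = 1 - (v + (1 + θ)⁻¹ + w ^ (-θ)) ^ (-1 / θ) := by
    intro w hw
    have h1 : Tendsto (fun k : ℕ => ∫ ω, Real.exp (-w * M k ω) ∂P) atTop
        (𝓝 (∫ ω, Real.exp (-w * W ω) ∂P)) := by
      refine tendsto_integral_of_dominated_convergence (fun _ => 1) (fun k => ?_)
        (integrable_const _) (fun k => .of_forall fun ω => ?_) ?_
      · exact (Real.continuous_exp.comp (continuous_const.mul
          continuous_id)).comp_aestronglyMeasurable (hM.integrable k).aestronglyMeasurable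
      · rw [Real.norm_of_nonneg (Real.exp_nonneg _), Real.exp_le_one_iff]
        have := mul_nonneg hw.le (hM0 k ω)
        linarith
      · filter_upwards [hlim] with ω hω
        exact (Real.continuous_exp.tendsto _).comp (hω.const_mul (-w))
    refine tendsto_nhds_unique h1 (((h.tendsto_laplace hw hm hv).comp
      tendsto_natCast_atTop_atTop).congr fun k => ?_)
    exact (integral_exp_normalized h hZ k hw).symm
  refine ⟨W, hWmeas, hW0, ?_, hlap⟩
  refine ae_tendsto_of_integral_le hM (fun ω t => ?_) hM0 hWint hlim ?_
  · refine ContinuousWithinAt.mul ?_ ?_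
    · exact (Real.continuous_exp.comp h.continuous_logMean.neg).continuousWithinAt
    · exact (continuous_of_discreteTopology (f := (Nat.cast : ℕ → ℝ))).continuousAt
        |>.comp_continuousWithinAt (hZ.right_continuous ω t)
  · rw [hM1]
    -- The mean of W is at least 1: 1 - wx ≤ e^{-wx} gives w E(W) ≥ 1 - E(e^{-wW}). Divide the
    -- explicit value by w and let w → 0.
    refine le_of_tendsto (x := 𝓝[>] (0 : ℝ))
      (f := fun w : ℝ => (1 + (v + (1 + θ)⁻¹) * w ^ θ) ^ (-1 / θ)) ?_ ?_
    · simpa using tendsto_rpow_neg_inv_add (A := 1) (D := v + (1 + θ)⁻¹) h0 zero_lt_one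
    · filter_upwards [self_mem_nhdsWithin] with w (hw : 0 < w)
      have h1 : (v + (1 + θ)⁻¹ + w ^ (-θ)) ^ (-1 / θ)
          = w * (1 + (v + (1 + θ)⁻¹) * w ^ θ) ^ (-1 / θ) := by
        rw [← rpow_neg_inv_add h0 hw zero_le_one (by positivity), one_mul, add_comm]
      have h2 : Integrable (fun ω => Real.exp (-w * W ω)) P := by
        refine Integrable.of_bound
          (Real.measurable_exp.comp (hWmeas.const_mul (-w))).aestronglyMeasurable 1 ?_
        filter_upwards [hW0] with ω hω
        rw [Real.norm_of_nonneg (Real.exp_nonneg _), Real.exp_le_one_iff]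
        have := mul_nonneg hw.le hω
        linarith
      have h3 : ∫ ω, (1 - w * W ω) ∂P ≤ ∫ ω, Real.exp (-w * W ω) ∂P :=
        integral_mono ((integrable_const 1).sub (hWint.const_mul w)) h2 fun ω => by
          have := Real.add_one_le_exp (-w * W ω)
          simp only
          linarith
      rw [hlap w hw, h1, integral_sub (integrable_const 1) (hWint.const_mul w),
        integral_const_mul] at h3
      simp only [integral_const, probReal_univ, one_smul] at h3
      exact le_of_mul_le_mul_left (by linarith) hw

theorem V_mean_eq (h : Admissible θ lam a)
    (hZ : IsMarkovBranchingProcess P ℱ lam (fun t => offspring θ (a t)) Z) (t : ℝ≥0) :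
    V θ lam (mean P Z) t = V' θ lam a t := by
  rw [V, V', ← intervalIntegral.integral_const_mul]
  refine intervalIntegral.integral_congr fun u hu => ?_
  rw [uIcc_of_le t.coe_nonneg] at hu
  rw [mean_eq h hZ, Real.coe_toNNReal u hu.1, ← Real.exp_mul, mul_comm (logMean lam a u)]

end Supercritical

end ThetaBranching

end

/-! ### The supercriticality criterion, the extinction probability and the limit law -/

theorem theorem2 {Ω : Type*} {mΩ : MeasurableSpace Ω} (P : Measure Ω) [IsProbabilityMeasure P]
    (ℱ : Filtration ℝ≥0 mΩ) (θ : ℝ) (hθ : 0 < θ) (hθ1 : θ ≤ 1)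
    (lam a : ℝ → ℝ)
    (hlam : ∀ t, 0 ≤ t → 0 ≤ lam t)
    (hlam_int : ∀ t, 0 ≤ t → IntervalIntegrable lam volume 0 t)
    (ha_meas : Measurable a)
    (ha : ∀ t, 0 ≤ t → 0 ≤ a t ∧ a t ≤ 1 + 1 / θ)
    (Z : ℝ≥0 → Ω → ℕ)
    (hZ : ThetaBranching.IsMarkovBranchingProcess P ℱ lam
      (fun t => ThetaBranching.offspring θ (a t)) Z) :
    -- the mean population size is finite and explicit
    (∀ t : ℝ≥0, Integrable (fun ω => (Z t ω : ℝ)) P ∧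
      ThetaBranching.mean P Z t = Real.exp (∫ u in (0 : ℝ)..t, (a u - 1) * lam u)) ∧
    -- supercritical if and only if `V_θ < ∞` and `Λ = ∞`
    (ThetaBranching.IsSupercritical P Z ↔
      (∃ v : ℝ, Tendsto (ThetaBranching.V θ lam (ThetaBranching.mean P Z)) atTop (𝓝 v)) ∧
        Tendsto (ThetaBranching.cumHazard lam) atTop atTop) ∧
    -- in this case, with `v = V_θ`
    (ThetaBranching.IsSupercritical P Z →
      ∃ v : ℝ, Tendsto (ThetaBranching.V θ lam (ThetaBranching.mean P Z)) atTop (𝓝 v) ∧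
        Tendsto (ThetaBranching.mean P Z) atTop atTop ∧
        Tendsto (fun t => P.real {ω | Z t ω = 0}) atTop
          (𝓝 (1 - (v + (1 + θ)⁻¹) ^ (-1 / θ))) ∧
        ∃ W : Ω → ℝ, Measurable W ∧ (∀ᵐ ω ∂P, 0 ≤ W ω) ∧
          (∀ᵐ ω ∂P, Tendsto (fun t => (ThetaBranching.mean P Z t)⁻¹ * (Z t ω : ℝ)) atTop
            (𝓝 (W ω))) ∧
          ∀ w : ℝ, 0 < w →
            ∫ ω, Real.exp (-w * W ω) ∂P
              = 1 - (v + (1 + θ)⁻¹ + w ^ (-θ)) ^ (-1 / θ)) := by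
  have h : ThetaBranching.Admissible θ lam a := ⟨hθ, hθ1, hlam, hlam_int, ha_meas,
    fun t ht => (ha t ht).1, fun t ht => (ha t ht).2⟩
  have hmean : ThetaBranching.mean P Z
      = fun t : ℝ≥0 => Real.exp (ThetaBranching.logMean lam a t) :=
    funext (ThetaBranching.mean_eq h hZ)
  have hV : ThetaBranching.V θ lam (ThetaBranching.mean P Z)
      = fun t : ℝ≥0 => ThetaBranching.V' θ lam a t := funext (ThetaBranching.V_mean_eq h hZ)
  have hmean_iff : Tendsto (ThetaBranching.mean P Z) atTop atTop
      ↔ Tendsto (fun t : ℝ≥0 => ThetaBranching.logMean lam a t) atTop atTop := by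
    rw [hmean]
    exact Real.tendsto_exp_comp_atTop
  have hforward : ThetaBranching.IsSupercritical P Z →
      ∃ v : ℝ, Tendsto (fun t : ℝ≥0 => ThetaBranching.V' θ lam a t) atTop (𝓝 v) := by
    rintro ⟨⟨q, hq, hlim⟩, hm⟩
    exact ThetaBranching.exists_tendsto_V' h hZ hq hlim (hmean_iff.1 hm)
  refine ⟨fun t => ⟨ThetaBranching.integrable_state h hZ t, ThetaBranching.mean_eq h hZ t⟩,
    ⟨fun hsup => ⟨hV ▸ hforward hsup, ?_⟩, ?_⟩, fun hsup => ?_⟩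
  -- Λ = ∞ because log μ_t ≤ Λ_t / θ and log μ_t → ∞.
  · refine (tendsto_const_mul_atTop_of_pos (one_div_pos.2 hθ)).1
      (tendsto_atTop_mono h.logMean_le (hmean_iff.1 hsup.2))
  · rintro ⟨⟨v, hv⟩, hΛ⟩
    rw [hV] at hv
    have hm := h.tendsto_logMean hv hΛ
    have hv0 : 0 ≤ v := ge_of_tendsto' hv h.V'_nonneg
    refine ⟨⟨_, ?_, ThetaBranching.tendsto_extinction_prob h hZ hm hv⟩, hmean_iff.2 hm⟩
    have : 0 < (v + (1 + θ)⁻¹) ^ (-1 / θ) := by positivity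
    linarith
  · obtain ⟨v, hv⟩ := hforward hsup
    have hm := hmean_iff.1 hsup.2
    obtain ⟨W, hW, hW0, hWlim, hWlap⟩ := ThetaBranching.exists_limit_normalized h hZ hm hv
    refine ⟨v, hV ▸ hv, hsup.2, ThetaBranching.tendsto_extinction_prob h hZ hm hv,
      W, hW, hW0, ?_, hWlap⟩
    filter_upwards [hWlim] with ω hω
    refine hω.congr fun t => ?_
    rw [hmean, Real.exp_neg]
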